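/- Consider a single-antenna splitting receiver with channel coefficient $\tilde h_1\in\mathbb C\setminus\{0\}$, received power parameter $P>0$ and power splitting ratio $\rho\in[0,1]$. Put $\Theta_1=\rho|\tilde h_1|^2$ and $\Theta_2=(1-\rho)^2|\tilde h_1|^4$. The input of the channel is $\sqrt P\tilde X$ and its output is $(\tilde Y_1,Y_2)$, where $$\tilde Y_1=\sqrt{\Theta_1}\sqrt P\,\tilde X+\tilde Z,\qquad Y_2=\sqrt{\Theta_2}\,P|\tilde X|^2+N,$$ with $\tilde X\sim\mathcal{CN}(0,1)$, $\tilde Z\sim\mathcal{CN}(0,\sigma_1^2)$ and $N\sim\mathcal N(0,\sigma_2^2)$ independent, $\sigma_1,\sigma_2>0$ fixed ($\mathcal{CN}(0,v)$ is the circularly symmetric complex Gaussian law of total variance $v$). Let $\mathcal I_P(\rho)=\mathcal I(\sqrt P\tilde X;\tilde Y_1,Y_2)$ be the mutual information in bits, and let $\gamma$ be Euler's constant. The high SNR regime is $P\to\infty$. Then $\sup_{\rho\in[0,1]}\mathcal I_P(\rho)<\infty$ for every $P>0$, and in the high SNR regime the optimal splitting ratio is $\rho^\star=1/3$, in the following sense.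 1. $\rho^\star=1/3$ is the unique maximizer over $[0,1]$ of $\rho(1-\rho)^2$, equivalently of $\Theta_1\Theta_2$. 2. For every $\varepsilon>0$ there is $\delta>0$ such that, for all sufficiently large $P$, every $\rho\in[0,1]$ with $|\rho-1/3|\ge\varepsilon$ satisfies $\mathcal I_P(\rho)+\delta\le\mathcal I_P(1/3)$. (In particular, any maximizers of $\mathcal I_P$ over $[0,1]$ tend to $1/3$ as $P\to\infty$.) 3. The maximal mutual information is asymptotically $$\log_2\left(\frac{2\sqrt2}{3\sqrt3}\,\frac{|\tilde h_1|^3P^{3/2}}{\sigma_1\sigma_2}\right)-\frac{\gamma}{2\ln 2}:$$ as $P\to\infty$, the difference between $\mathcal I_P(1/3)$ and this expression tends to $0$, and so does the difference between $\sup_{\rho\in[0,1]}\mathcal I_P(\rho)$ and this expression. -/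

import Mathlib

open MeasureTheory ProbabilityTheory Filter Topology
open scoped NNReal ENNReal

namespace SplittingReceiver

/-- The circularly symmetric complex Gaussian law `𝒞𝒩(0, v)` of total variance `v`: the real and
imaginary parts are independent, each with law `𝒩(0, v / 2)`. -/
noncomputable def complexGaussian (v : ℝ≥0) : Measure ℂ :=
  ((gaussianReal 0 (v / 2)).prod (gaussianReal 0 (v / 2))).map
    (fun p : ℝ × ℝ => (⟨p.1, p.2⟩ : ℂ))

/-- The mutual information `𝓘(U; V)` in bits: the Kullback-Leibler divergence of the joint law of
`(U, V)` from the product of the marginal laws, in nats, divided by `ln 2`. -/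
noncomputable def mutualInformation {Ω α β : Type*} [MeasurableSpace Ω] [MeasurableSpace α]
    [MeasurableSpace β] (μ : Measure Ω) (U : Ω → α) (V : Ω → β) : ℝ≥0∞ :=
  InformationTheory.klDiv (μ.map (fun ω => (U ω, V ω))) ((μ.map U).prod (μ.map V)) /
    ENNReal.ofReal (Real.log 2)

/-- `Θ₁ = ∑ ρₖ |hₖ|²` for `K` receiver antennas with channel coefficients `hₖ` and power
splitting ratios `ρₖ`. -/
noncomputable def theta₁ {K : ℕ} (h : Fin K → ℂ) (ρ : Fin K → ℝ) : ℝ :=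
  ∑ k, ρ k * ‖h k‖ ^ 2

/-- `Θ₂ = ∑ (1 - ρₖ)² |hₖ|⁴`. -/
noncomputable def theta₂ {K : ℕ} (h : Fin K → ℂ) (ρ : Fin K → ℝ) : ℝ :=
  ∑ k, (1 - ρ k) ^ 2 * ‖h k‖ ^ 4

/-- The output `(Y₁, Y₂) = (√Θ₁ √P x + z, √Θ₂ P |x|² + n)` of the splitting channel, for the
transmitted signal `x`, the coherent-branch noise `z` and the power-detection noise `n`. -/
noncomputable def channelOutput {K : ℕ} (h : Fin K → ℂ) (P : ℝ) (ρ : Fin K → ℝ)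
    (x z : ℂ) (n : ℝ) : ℂ × ℝ :=
  (((√(theta₁ h ρ) * √P : ℝ) : ℂ) * x + z, √(theta₂ h ρ) * P * ‖x‖ ^ 2 + n)

/-- The mutual information, in bits, between the input `√P X` and the output `(Y₁, Y₂)` of the
splitting channel. -/
noncomputable def splittingInformation {Ω : Type*} [MeasurableSpace Ω] {K : ℕ} (μ : Measure Ω)
    (X Z : Ω → ℂ) (N : Ω → ℝ) (h : Fin K → ℂ) (P : ℝ) (ρ : Fin K → ℝ) : ℝ≥0∞ :=
  mutualInformation μ (fun ω => ((√P : ℝ) : ℂ) * X ω)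
    (fun ω => channelOutput h P ρ (X ω) (Z ω) (N ω))

/-- The mutual information of the single-antenna splitting receiver with channel coefficient `h`
and splitting ratio `ρ`. -/
noncomputable def singleAntennaInformation {Ω : Type*} [MeasurableSpace Ω] (μ : Measure Ω)
    (X Z : Ω → ℂ) (N : Ω → ℝ) (h : ℂ) (P ρ : ℝ) : ℝ≥0∞ :=
  splittingInformation μ X Z N (fun _ : Fin 1 => h) P (fun _ : Fin 1 => ρ)

/-- `log₂ ((2√2 / (3√3)) · |h|³ P^{3/2} / (σ₁ σ₂)) - γ / (2 ln 2)`. -/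
noncomputable def highSNRValue (h : ℂ) (σ₁ σ₂ P : ℝ) : ℝ :=
  Real.logb 2 (2 * √2 / (3 * √3) * (‖h‖ ^ 3 * P ^ (3 / 2 : ℝ) / (σ₁ * σ₂))) -
    Real.eulerMascheroniConstant / (2 * Real.log 2)

end SplittingReceiver

/-! At high power the two branches locate the input in polar coordinates: the power branch measures
`|X|²` up to noise of fixed variance, and the linear branch supplies the phase, with error variance
about `σ / (2α²|X|²)` for gain `α` and noise variance `σ`. Two bounds on the divergence make this
picture exact up to `o(1)`.

Upper bound, for every `ρ`. The information is at most the mean of `log (w / q)`, where `w` is the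
transition density and `q` any output density (`toReal_klDiv_prod_snd_le_integral`). Take for `q`
the true Gaussian law of the linear output times a Gaussian law for the power output with the true
conditional mean and variance given the linear output. Since second moments match, all quadratic
terms cancel in the mean and only logarithms of variances remain:
`IsGaussianChannel.toReal_klDiv_le` gives `½ E log ((1+a)² + b(1+2a|w|²))`, with `w` standard
complex Gaussian and `a = AρP`, `b = B(1-ρ)²P²` the signal to noise ratios. The only term cubic in
`P` is `2ABρ(1-ρ)²P³|w|²`, the others being `O(P²)` uniformly in `ρ`
(`informationBound_le_highPowerBound`). As `|w|²` is standard exponential, `E log |w|² = Γ'(1) =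
-γ`, which is the origin of Euler's constant.

Lower bound, needed only at `ρ = 1/3`. By the Gibbs variational principle
(`integral_le_toReal_klDiv`) any guess for the law of the input given the output gives a lower
bound. The guess is the polar picture: `k|x|²` Gaussian about the power output (`k` the gain of that
branch), the phase Gaussian about that of the linear output. The result,
`IsGaussianChannel.le_toReal_klDiv`, has the desired value plus `½ - E(α|X|·phase error)²/σ`, which
tends to `0` by dominated convergence (`IsGaussianChannel.tendsto_integral_sq_phaseError`).

Both bounds agree in the limit when `ρ(1-ρ)²` takes its maximum `4/27`. Away from `1/3` that product
is smaller, and the upper bound falls short by a constant. -/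

namespace SplittingReceiver

/-! ### Variational bounds on the Kullback-Leibler divergence -/

section Divergence

open InformationTheory

variable {E : Type*} [MeasurableSpace E]

/-- An upper bound on the divergence of `f • τ` from `τ`, by Jensen's inequality. -/
theorem toReal_klDiv_le_integral {π τ : Measure E} [IsProbabilityMeasure π]
    [IsProbabilityMeasure τ] {f : E → ℝ≥0∞} (hf : Measurable f) (hπ : π = τ.withDensity f)
    {g : E → ℝ} (hg : Integrable g π)
    (hfg : ∫⁻ x, f x * ENNReal.ofReal (Real.exp (-g x)) ∂π ≤ 1) :
    klDiv π τ ≠ ⊤ ∧ (klDiv π τ).toReal ≤ ∫ x, g x ∂π := by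
  have hac : π ≪ τ := hπ ▸ withDensity_absolutelyContinuous τ f
  have hrn : π.rnDeriv τ =ᵐ[π] f := by
    apply hac.ae_le
    have h := Measure.rnDeriv_withDensity τ hf
    rwa [← hπ] at h
  have hpos : ∀ᵐ x ∂π, 0 < f x := by
    filter_upwards [hrn, Measure.rnDeriv_pos hac] with x h1 h2 using h1 ▸ h2
  have htop : ∀ᵐ x ∂π, f x < ⊤ := by
    filter_upwards [hrn, hac.ae_le (Measure.rnDeriv_lt_top π τ)] with x h1 h2 using h1 ▸ h2
  have hllr : ∀ᵐ x ∂π, llr π τ x = Real.log (f x).toReal := by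
    filter_upwards [hrn] with x h1
    simp [llr_def, h1]
  have hexp1 : ∀ᵐ x ∂π, ENNReal.ofReal (Real.exp (llr π τ x - g x)) =
      f x * ENNReal.ofReal (Real.exp (-g x)) := by
    filter_upwards [hpos, htop, hllr] with x h1 h2 h3
    rw [sub_eq_add_neg, Real.exp_add, h3, Real.exp_log (ENNReal.toReal_pos h1.ne' h2.ne),
      ENNReal.ofReal_mul ENNReal.toReal_nonneg, ENNReal.ofReal_toReal h2.ne]
  have hexp2 : ∀ᵐ x ∂π, ENNReal.ofReal (Real.exp (-llr π τ x)) = (f x)⁻¹ := by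
    filter_upwards [hpos, htop, hllr] with x h1 h2 h3
    rw [Real.exp_neg, h3, Real.exp_log (ENNReal.toReal_pos h1.ne' h2.ne),
      ENNReal.ofReal_inv_of_pos (ENNReal.toReal_pos h1.ne' h2.ne), ENNReal.ofReal_toReal h2.ne]
  have hmeas : AEStronglyMeasurable (llr π τ) π :=
    (measurable_llr π τ).aestronglyMeasurable
  have hI1 : ∫⁻ x, ENNReal.ofReal (Real.exp (llr π τ x - g x)) ∂π ≤ 1 := by
    rwa [lintegral_congr_ae hexp1]
  -- Needed only for integrability of `llr`: it controls the negative part, while `g` and `exp (llr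
  -- - g)` control the positive part.
  have hI2 : ∫⁻ x, ENNReal.ofReal (Real.exp (-llr π τ x)) ∂π ≤ 1 := by
    rw [lintegral_congr_ae hexp2]
    calc ∫⁻ x, (f x)⁻¹ ∂π = ∫⁻ x, f x * (f x)⁻¹ ∂τ := by
          rw [hπ, lintegral_withDensity_eq_lintegral_mul (g := fun x => (f x)⁻¹) _ hf hf.inv]
          rfl
      _ ≤ ∫⁻ _, 1 ∂τ := lintegral_mono fun x => ENNReal.mul_inv_le_one _
      _ = 1 := by simp
  have hint1 : Integrable (fun x => Real.exp (llr π τ x - g x)) π := by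
    refine ⟨(Real.continuous_exp.comp_aestronglyMeasurable (hmeas.sub hg.1)), ?_⟩
    rw [hasFiniteIntegral_iff_ofReal (ae_of_all _ fun x => (Real.exp_pos _).le)]
    exact hI1.trans_lt ENNReal.one_lt_top
  have hint2 : Integrable (fun x => Real.exp (-llr π τ x)) π := by
    refine ⟨(Real.continuous_exp.comp_aestronglyMeasurable hmeas.neg), ?_⟩
    rw [hasFiniteIntegral_iff_ofReal (ae_of_all _ fun x => (Real.exp_pos _).le)]
    exact hI2.trans_lt ENNReal.one_lt_top
  have hint : Integrable (llr π τ) π := by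
    refine ((hg.abs.add hint1).add hint2).mono' hmeas (ae_of_all _ fun x => ?_)
    have h1 := Real.add_one_le_exp (llr π τ x - g x)
    have h2 := Real.add_one_le_exp (-llr π τ x)
    have h3 := le_abs_self (g x)
    have h4 := abs_nonneg (g x)
    have h5 := Real.exp_pos (llr π τ x - g x)
    have h6 := Real.exp_pos (-llr π τ x)
    simp only [Real.norm_eq_abs, Pi.add_apply]
    rw [abs_le]
    constructor <;> linarith
  refine ⟨klDiv_ne_top hac hint, ?_⟩
  rw [toReal_klDiv_of_measure_eq hac (by simp)]
  have hle : ∫ x, Real.exp (llr π τ x - g x) ∂π ≤ 1 := by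
    rw [integral_eq_lintegral_of_nonneg_ae (ae_of_all _ fun x => (Real.exp_pos _).le) hint1.1]
    exact ENNReal.toReal_le_of_le_ofReal zero_le_one (by simpa using hI1)
  -- Jensen's inequality through `u ≤ exp u - 1` at `u = llr - g`; the exponential moment is at most
  -- `1` and cancels the constant.
  have hmono : ∫ x, llr π τ x ∂π ≤ ∫ x, (g x + Real.exp (llr π τ x - g x) - 1) ∂π := by
    refine integral_mono hint ((hg.add hint1).sub (integrable_const 1)) fun x => ?_
    have h1 := Real.add_one_le_exp (llr π τ x - g x)
    linarith
  rw [integral_sub (f := fun x => g x + Real.exp (llr π τ x - g x)) (hg.add hint1)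
    (integrable_const 1), integral_add hg hint1] at hmono
  simp only [integral_const, probReal_univ, smul_eq_mul, mul_one] at hmono
  linarith

/-- A variational lower bound on the divergence (Gibbs, Donsker-Varadhan). -/
theorem integral_le_toReal_klDiv {π τ : Measure E} [IsProbabilityMeasure π]
    [IsProbabilityMeasure τ] (hkl : klDiv π τ ≠ ⊤) {g : E → ℝ} (hgm : Measurable g)
    (hg : Integrable g π) (hgτ : ∫⁻ x, ENNReal.ofReal (Real.exp (g x)) ∂τ ≤ 1) :
    ∫ x, g x ∂π ≤ (klDiv π τ).toReal := by
  obtain ⟨hac, hint⟩ := klDiv_ne_top_iff.1 hkl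
  rw [toReal_klDiv_of_measure_eq hac (by simp)]
  have hexp : ∀ᵐ x ∂π, ENNReal.ofReal (Real.exp (g x - llr π τ x)) =
      (π.rnDeriv τ x)⁻¹ * ENNReal.ofReal (Real.exp (g x)) := by
    filter_upwards [Measure.rnDeriv_pos hac, hac.ae_le (Measure.rnDeriv_lt_top π τ)] with x h1 h2
    have h3 := ENNReal.toReal_pos h1.ne' h2.ne
    rw [llr_def, Real.exp_sub, Real.exp_log h3, div_eq_inv_mul,
      ENNReal.ofReal_mul (by positivity), ENNReal.ofReal_inv_of_pos h3,
      ENNReal.ofReal_toReal h2.ne]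
  -- Passing to `τ` cancels the density where it is nonzero and finite; elsewhere mass may be lost,
  -- hence only an inequality.
  have hI : ∫⁻ x, ENNReal.ofReal (Real.exp (g x - llr π τ x)) ∂π ≤ 1 := by
    rw [lintegral_congr_ae hexp]
    calc ∫⁻ x, (π.rnDeriv τ x)⁻¹ * ENNReal.ofReal (Real.exp (g x)) ∂π
        = ∫⁻ x, π.rnDeriv τ x * ((π.rnDeriv τ x)⁻¹ * ENNReal.ofReal (Real.exp (g x))) ∂τ := by
          rw [lintegral_rnDeriv_mul hac (by fun_prop)]
      _ ≤ ∫⁻ x, ENNReal.ofReal (Real.exp (g x)) ∂τ := lintegral_mono fun x => by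
          rw [← mul_assoc]
          exact mul_le_of_le_one_left' (ENNReal.mul_inv_le_one _)
      _ ≤ 1 := hgτ
  have hmeas : AEStronglyMeasurable (llr π τ) π :=
    (measurable_llr π τ).aestronglyMeasurable
  have hint1 : Integrable (fun x => Real.exp (g x - llr π τ x)) π := by
    refine ⟨(Real.continuous_exp.comp_aestronglyMeasurable (hg.1.sub hmeas)), ?_⟩
    rw [hasFiniteIntegral_iff_ofReal (ae_of_all _ fun x => (Real.exp_pos _).le)]
    exact hI.trans_lt ENNReal.one_lt_top
  have hle : ∫ x, Real.exp (g x - llr π τ x) ∂π ≤ 1 := by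
    rw [integral_eq_lintegral_of_nonneg_ae (ae_of_all _ fun x => (Real.exp_pos _).le) hint1.1]
    exact ENNReal.toReal_le_of_le_ofReal zero_le_one (by simpa using hI)
  have hmono : ∫ x, g x ∂π ≤ ∫ x, (llr π τ x + Real.exp (g x - llr π τ x) - 1) ∂π := by
    refine integral_mono hg ((hint.add hint1).sub (integrable_const 1)) fun x => ?_
    have h1 := Real.add_one_le_exp (g x - llr π τ x)
    linarith
  rw [integral_sub (f := fun x => llr π τ x + Real.exp (g x - llr π τ x)) (hint.add hint1)
    (integrable_const 1), integral_add hint hint1] at hmono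
  simp only [integral_const, probReal_univ, smul_eq_mul, mul_one] at hmono
  linarith

variable {α β : Type*} [MeasurableSpace α] [MeasurableSpace β]

/-- The mutual information of a joint law with conditional density `w` is at most the mean of
`log (w / q)`, for every output density `q`. -/
theorem toReal_klDiv_prod_snd_le_integral (ν₁ : Measure α) [IsProbabilityMeasure ν₁]
    (ν : Measure β) [SigmaFinite ν] {w : α × β → ℝ≥0∞} (hw : Measurable w)
    (hw0 : ∀ z, w z ≠ 0) {π : Measure (α × β)} [IsProbabilityMeasure π]
    (hπ : π = (ν₁.prod ν).withDensity w) {q : β → ℝ≥0∞} (hq : Measurable q)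
    (hq1 : ∫⁻ y, q y ∂ν ≤ 1) {g : α × β → ℝ} (hg : Integrable g π)
    (hgq : ∀ z, w z * ENNReal.ofReal (Real.exp (-g z)) = q z.2) :
    klDiv π (ν₁.prod π.snd) ≠ ⊤ ∧
      (klDiv π (ν₁.prod π.snd)).toReal ≤ ∫ z, g z ∂π := by
  set p : β → ℝ≥0∞ := fun y => ∫⁻ x, w (x, y) ∂ν₁ with hp
  have hpm : Measurable p := hw.lintegral_prod_left'
  have hsnd : π.snd = ν.withDensity p := by
    ext s hs
    rw [Measure.snd_apply hs, hπ, withDensity_apply _ (measurable_snd hs),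
      withDensity_apply _ hs, ← lintegral_indicator (measurable_snd hs),
      lintegral_prod_symm' _ (hw.indicator (measurable_snd hs)), ← lintegral_indicator hs]
    refine lintegral_congr fun y => ?_
    by_cases hy : y ∈ s
    · simp [Set.indicator, hy, hp]
    · simp [Set.indicator, hy]
  have hp0 : ∀ y, p y ≠ 0 := fun y h => by
    have h := (lintegral_eq_zero_iff (hw.comp (measurable_prodMk_right (y := y)))).1 h
    have : ∀ᵐ _ ∂ν₁, False := h.mono fun x hx => hw0 _ hx
    exact IsProbabilityMeasure.ne_zero ν₁ (by simpa using this)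
  have hpfin : ∫⁻ y, p y ∂ν = 1 := by
    have h1 : π.snd Set.univ = 1 := measure_univ
    rwa [hsnd, withDensity_apply _ MeasurableSet.univ, Measure.restrict_univ] at h1
  have hptop : ∀ᵐ y ∂ν, p y < ⊤ := ae_lt_top hpm (by simp [hpfin])
  have hptop' : ∀ᵐ z ∂(ν₁.prod ν), p z.2 < ⊤ := Measure.quasiMeasurePreserving_snd.ae hptop
  have hfm : Measurable fun z : α × β => w z / p z.2 := hw.div (hpm.comp measurable_snd)
  refine toReal_klDiv_le_integral hfm ?_ hg ?_
  · have hpm' : Measurable fun z : α × β => p z.2 := hpm.comp measurable_snd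
    rw [hsnd, prod_withDensity_right hpm, ← withDensity_mul _ hpm' hfm, hπ]
    refine withDensity_congr_ae ?_
    filter_upwards [hptop'] with z hz
    simp only [Pi.mul_apply]
    rw [ENNReal.mul_div_cancel (hp0 _) hz.ne]
  -- The density of `π` relative to the product of marginals is `w / p`, with `p` the true output
  -- density. Tilting by `exp (-g)` leaves `q / p`, a function of the output alone, whose mean is at
  -- most the mass of `q`.
  · have h1 : ∀ z, w z / p z.2 * ENNReal.ofReal (Real.exp (-g z)) = q z.2 / p z.2 := fun z => by
      rw [← hgq z, div_eq_mul_inv, div_eq_mul_inv]; ring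
    simp_rw [h1]
    calc ∫⁻ z, q z.2 / p z.2 ∂π = ∫⁻ y, q y / p y ∂π.snd := by
          rw [Measure.snd, lintegral_map (f := fun y => q y / p y) (hq.div hpm) measurable_snd]
      _ = ∫⁻ y, p y * (q y / p y) ∂ν := by
          rw [hsnd, lintegral_withDensity_eq_lintegral_mul (g := fun y => q y / p y) _ hpm
            (hq.div hpm)]; rfl
      _ ≤ ∫⁻ y, q y ∂ν := lintegral_mono fun y => ENNReal.mul_div_le
      _ ≤ 1 := hq1

end Divergence

/-! ### Complex Gaussian law: density, linear estimation, polar coordinates -/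

section ComplexGaussian

/-- The density of the circularly symmetric complex Gaussian law of total variance `v`. -/
noncomputable def complexGaussianPDFReal (v : ℝ) (z : ℂ) : ℝ :=
  (Real.pi * v)⁻¹ * Real.exp (-‖z‖ ^ 2 / v)

@[fun_prop]
theorem measurable_complexGaussianPDFReal (v : ℝ) : Measurable (complexGaussianPDFReal v) := by
  unfold complexGaussianPDFReal; fun_prop

theorem complexGaussianPDFReal_pos {v : ℝ} (hv : 0 < v) (z : ℂ) :
    0 < complexGaussianPDFReal v z := by
  unfold complexGaussianPDFReal; positivity

instance (v : ℝ≥0) : IsProbabilityMeasure (complexGaussian v) := by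
  unfold complexGaussian
  exact Measure.isProbabilityMeasure_map
    (Complex.measurableEquivRealProd.symm.measurable.aemeasurable)

theorem complexGaussian_toNNReal_eq_withDensity {v : ℝ} (hv : 0 < v) :
    complexGaussian v.toNNReal =
      volume.withDensity fun z => ENNReal.ofReal (complexGaussianPDFReal v z) := by
  have hv2 : v.toNNReal / 2 ≠ 0 := by
    have := Real.toNNReal_pos.2 hv
    positivity
  have hc : ((v.toNNReal / 2 : ℝ≥0) : ℝ) = v / 2 := by
    rw [NNReal.coe_div, Real.coe_toNNReal _ hv.le]; rfl
  have hmeas : Measurable fun z : ℂ => ENNReal.ofReal (complexGaussianPDFReal v z) := by fun_prop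
  refine Measure.ext_of_lintegral _ fun F hF => ?_
  have he := Complex.volume_preserving_equiv_real_prod.symm
  have hpdf : Measurable fun z : ℝ × ℝ => gaussianPDF 0 (v.toNNReal / 2) z.1 *
      gaussianPDF 0 (v.toNNReal / 2) z.2 :=
    ((measurable_gaussianPDF _ _).comp measurable_fst).mul
      ((measurable_gaussianPDF _ _).comp measurable_snd)
  have hmap : (fun p : ℝ × ℝ => (⟨p.1, p.2⟩ : ℂ)) = Complex.measurableEquivRealProd.symm := rfl
  rw [complexGaussian, hmap, lintegral_map hF Complex.measurableEquivRealProd.symm.measurable,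
    lintegral_withDensity_eq_lintegral_mul _ hmeas hF,
    ← he.lintegral_comp_emb Complex.measurableEquivRealProd.symm.measurableEmbedding,
    gaussianReal_of_var_ne_zero _ hv2,
    prod_withDensity (measurable_gaussianPDF _ _) (measurable_gaussianPDF _ _),
    lintegral_withDensity_eq_lintegral_mul
      (g := fun p => F (Complex.measurableEquivRealProd.symm p)) _
      hpdf (hF.comp Complex.measurableEquivRealProd.symm.measurable)]
  refine lintegral_congr fun p => ?_
  change _ * F _ = _ * F _
  congr 1
  simp only [gaussianPDF]
  rw [← ENNReal.ofReal_mul (gaussianPDFReal_nonneg _ _ _), gaussianPDFReal, gaussianPDFReal, hc,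
    complexGaussianPDFReal, mul_mul_mul_comm, ← Real.exp_add, ← mul_inv,
    Real.mul_self_sqrt (by positivity), Complex.sq_norm, Complex.normSq_apply]
  change _ = ENNReal.ofReal (_ * Real.exp (-(p.1 * p.1 + p.2 * p.2) / v))
  congr 3 <;> field_simp
  ring

theorem complexGaussian_one_eq_toNNReal :
    complexGaussian 1 = complexGaussian (1 : ℝ).toNNReal := by simp

theorem lintegral_complexGaussian {v : ℝ} (hv : 0 < v) {F : ℂ → ℝ≥0∞} (hF : Measurable F) :
    ∫⁻ z, F z ∂complexGaussian v.toNNReal =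
      ∫⁻ z, ENNReal.ofReal (complexGaussianPDFReal v z) * F z := by
  rw [complexGaussian_toNNReal_eq_withDensity hv,
    lintegral_withDensity_eq_lintegral_mul _ (by fun_prop) hF]
  rfl

/-- Completing the square: the joint Gaussian density of input and output, factored in the two
possible orders. -/
theorem complexGaussianPDFReal_mul (α : ℝ) {σ τ : ℝ} (hσ : 0 < σ) (hτ : τ = α ^ 2 + σ)
    (x y : ℂ) :
    complexGaussianPDFReal 1 x * complexGaussianPDFReal σ (y - (α : ℂ) * x) =
      complexGaussianPDFReal τ y *
        complexGaussianPDFReal (σ / τ) (x - ((α / τ : ℝ) : ℂ) * y) := by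
  have hτ0 : 0 < τ := by rw [hτ]; positivity
  unfold complexGaussianPDFReal
  have key : ∀ a b c d : ℝ, a * Real.exp b * (c * Real.exp d) = a * c * Real.exp (b + d) :=
    fun a b c d => by rw [Real.exp_add]; ring
  rw [key, key]
  congr 1
  · field_simp
  · congr 1
    simp only [Complex.sq_norm, Complex.normSq_apply, Complex.sub_re, Complex.sub_im,
      Complex.re_ofReal_mul, Complex.im_ofReal_mul]
    field_simp
    subst hτ
    ring

/-- The output of a Gaussian channel is independent of the error of the linear estimate of the
input, and both are Gaussian. -/
theorem map_prod_complexGaussian (α : ℝ) {σ τ : ℝ} (hσ : 0 < σ) (hτ : τ = α ^ 2 + σ) :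
    ((complexGaussian 1).prod (complexGaussian σ.toNNReal)).map
        (fun p : ℂ × ℂ => ((α : ℂ) * p.1 + p.2,
          p.1 - ((α / τ : ℝ) : ℂ) * ((α : ℂ) * p.1 + p.2))) =
      (complexGaussian τ.toNNReal).prod (complexGaussian (σ / τ).toNNReal) := by
  have hτ0 : 0 < τ := by rw [hτ]; positivity
  have hs : 0 < σ / τ := by positivity
  refine Measure.ext_of_lintegral _ fun F hF => ?_
  rw [lintegral_map hF (by fun_prop), lintegral_prod _ (by fun_prop), lintegral_prod _ (by fun_prop),
    complexGaussian_one_eq_toNNReal, lintegral_complexGaussian one_pos (by fun_prop),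
    lintegral_complexGaussian hτ0 (by fun_prop)]
  calc ∫⁻ x, ENNReal.ofReal (complexGaussianPDFReal 1 x) *
        ∫⁻ z, F ((α : ℂ) * x + z, x - ((α / τ : ℝ) : ℂ) * ((α : ℂ) * x + z))
          ∂complexGaussian σ.toNNReal
      = ∫⁻ x, ∫⁻ y, ENNReal.ofReal (complexGaussianPDFReal 1 x *
          complexGaussianPDFReal σ (y - (α : ℂ) * x)) * F (y, x - ((α / τ : ℝ) : ℂ) * y) := by
        refine lintegral_congr fun x => ?_
        rw [lintegral_complexGaussian hσ (by fun_prop), ← lintegral_const_mul _ (by fun_prop)]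
        conv_rhs => rw [← lintegral_add_left_eq_self _ ((α : ℂ) * x)]
        refine lintegral_congr fun z => ?_
        rw [add_sub_cancel_left, ENNReal.ofReal_mul (complexGaussianPDFReal_pos one_pos _).le,
          mul_assoc]
    _ = ∫⁻ y, ∫⁻ x, ENNReal.ofReal (complexGaussianPDFReal 1 x *
          complexGaussianPDFReal σ (y - (α : ℂ) * x)) * F (y, x - ((α / τ : ℝ) : ℂ) * y) := by
        refine lintegral_lintegral_swap (Measurable.aemeasurable ?_)
        simp only [Function.uncurry_def]
        fun_prop
    _ = _ := by
        refine lintegral_congr fun y => ?_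
        rw [lintegral_complexGaussian hs (by fun_prop), ← lintegral_const_mul _ (by fun_prop)]
        -- For fixed `y`, centring the input at its linear estimate turns the completed square into
        -- a product density.
        conv_rhs => rw [← lintegral_sub_right_eq_self _ (((α / τ : ℝ) : ℂ) * y)]
        refine lintegral_congr fun z => ?_
        rw [complexGaussianPDFReal_mul α hσ hτ,
          ENNReal.ofReal_mul (complexGaussianPDFReal_pos hτ0 _).le, mul_assoc]

/-- Substitution `t = k r²`. It serves both for the law of `|z|²` and, in the lower bound, for the
radial part of the guessed input law. -/
theorem lintegral_Ioi_comp_sq {k : ℝ} (hk : 0 < k) (G : ℝ → ℝ≥0∞) :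
    ∫⁻ r in Set.Ioi (0 : ℝ), ENNReal.ofReal (2 * k * r) * G (k * r ^ 2) =
      ∫⁻ t in Set.Ioi (0 : ℝ), G t := by
  have himg : (fun r : ℝ => k * r ^ 2) '' Set.Ioi 0 = Set.Ioi 0 := by
    ext t
    simp only [Set.mem_image, Set.mem_Ioi]
    constructor
    · rintro ⟨r, hr, rfl⟩; positivity
    · intro ht
      refine ⟨√(t / k), by positivity, ?_⟩
      rw [Real.sq_sqrt (by positivity)]; field_simp
  have hinj : Set.InjOn (fun r : ℝ => k * r ^ 2) (Set.Ioi 0) := by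
    intro a ha b hb hab
    have h1 := mul_left_cancel₀ hk.ne' hab
    exact (pow_left_inj₀ (le_of_lt ha) (le_of_lt hb) two_ne_zero).1 h1
  have hder : ∀ r ∈ Set.Ioi (0 : ℝ),
      HasDerivWithinAt (fun r : ℝ => k * r ^ 2) (2 * k * r) (Set.Ioi 0) r := fun r _ => by
    have := ((hasDerivAt_pow 2 r).const_mul k).hasDerivWithinAt (s := Set.Ioi 0)
    exact this.congr_deriv (by norm_num; ring)
  conv_rhs => rw [← himg]
  rw [lintegral_image_eq_lintegral_abs_deriv_mul measurableSet_Ioi hder hinj]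
  refine setLIntegral_congr_fun measurableSet_Ioi fun r hr => ?_
  have hr : 0 < r := hr
  rw [abs_of_pos (by positivity)]

/-- The squared modulus of a standard complex Gaussian variable is exponentially distributed. -/
theorem map_sq_norm_complexGaussian :
    (complexGaussian 1).map (fun z => ‖z‖ ^ 2) =
      (volume.restrict (Set.Ioi 0)).withDensity fun t => ENNReal.ofReal (Real.exp (-t)) := by
  refine Measure.ext_of_lintegral _ fun F hF => ?_
  rw [lintegral_map hF (by fun_prop), complexGaussian_one_eq_toNNReal,
    lintegral_complexGaussian one_pos (by fun_prop),
    lintegral_withDensity_eq_lintegral_mul _ (by fun_prop) hF,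
    ← Complex.lintegral_comp_polarCoord_symm, polarCoord_target, Measure.volume_eq_prod,
    ← Measure.prod_restrict, lintegral_prod _ (by
      unfold complexGaussianPDFReal
      simp only [Complex.norm_polarCoord_symm, smul_eq_mul]
      exact Measurable.aemeasurable (by fun_prop))]
  simp only [Complex.norm_polarCoord_symm, complexGaussianPDFReal, sq_abs, smul_eq_mul,
    lintegral_const, Measure.restrict_apply MeasurableSet.univ, Set.univ_inter, Real.volume_Ioo]
  conv_rhs => rw [← lintegral_Ioi_comp_sq one_pos]
  refine setLIntegral_congr_fun measurableSet_Ioi fun r hr => ?_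
  have hr : 0 < r := hr
  simp only [one_mul, Pi.mul_apply, mul_one, div_one, sub_neg_eq_add]
  rw [mul_right_comm, ← mul_assoc, ← mul_assoc, ← ENNReal.ofReal_mul hr.le,
    ← ENNReal.ofReal_mul (by positivity), ← ENNReal.ofReal_mul (by positivity)]
  congr 2
  field_simp
  ring

theorem integral_comp_sq_norm_complexGaussian {F : ℝ → ℝ} (hF : Measurable F) :
    ∫ z, F (‖z‖ ^ 2) ∂complexGaussian 1 = ∫ t in Set.Ioi (0 : ℝ), Real.exp (-t) * F t := by
  rw [← integral_map (f := F) (φ := fun z : ℂ => ‖z‖ ^ 2) (by fun_prop) hF.aestronglyMeasurable,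
    map_sq_norm_complexGaussian, integral_withDensity_eq_integral_toReal_smul (by fun_prop)
      (ae_of_all _ fun _ => ENNReal.ofReal_lt_top)]
  simp [ENNReal.toReal_ofReal (Real.exp_pos _).le]

theorem integrable_comp_sq_norm_complexGaussian {F : ℝ → ℝ}
    (h : IntegrableOn (fun t => Real.exp (-t) * F t) (Set.Ioi 0)) :
    Integrable (fun z => F (‖z‖ ^ 2)) (complexGaussian 1) := by
  have h1 : Integrable F ((complexGaussian 1).map fun z => ‖z‖ ^ 2) := by
    rw [map_sq_norm_complexGaussian, integrable_withDensity_iff_integrable_smul' (by fun_prop)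
      (ae_of_all _ fun _ => ENNReal.ofReal_lt_top)]
    simpa [ENNReal.toReal_ofReal (Real.exp_pos _).le, IntegrableOn] using h
  exact h1.comp_measurable (by fun_prop)

end ComplexGaussian

/-! ### Moments of the complex Gaussian law -/

section Moments

theorem integrableOn_exp_neg_mul_pow (n : ℕ) :
    IntegrableOn (fun t : ℝ => Real.exp (-t) * t ^ n) (Set.Ioi 0) := by
  have h := Real.GammaIntegral_convergent (s := n + 1) (by positivity)
  simpa using h

theorem integral_exp_neg_mul_pow (n : ℕ) :
    ∫ t in Set.Ioi (0 : ℝ), Real.exp (-t) * t ^ n = n.factorial := by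
  have h := Real.Gamma_eq_integral (s := n + 1) (by positivity)
  rw [Real.Gamma_nat_eq_factorial] at h
  simpa using h.symm

theorem integrable_sq_norm_pow (n : ℕ) :
    Integrable (fun z => (‖z‖ ^ 2) ^ n) (complexGaussian 1) :=
  integrable_comp_sq_norm_complexGaussian (F := fun t => t ^ n) (integrableOn_exp_neg_mul_pow n)

theorem integral_sq_norm_pow (n : ℕ) :
    ∫ z, (‖z‖ ^ 2) ^ n ∂complexGaussian 1 = n.factorial := by
  rw [integral_comp_sq_norm_complexGaussian (F := fun t => t ^ n) (by fun_prop),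
    integral_exp_neg_mul_pow]

/-- The integral is `Γ'(1)`, obtained by differentiating the Mellin transform of `exp (-t)` at `1`.
-/
theorem integrableOn_exp_neg_mul_log_and_integral :
    IntegrableOn (fun t : ℝ => Real.exp (-t) * Real.log t) (Set.Ioi 0) ∧
      ∫ t in Set.Ioi (0 : ℝ), Real.exp (-t) * Real.log t = -Real.eulerMascheroniConstant := by
  have hc : Continuous fun t : ℝ => ((Real.exp (-t) : ℝ) : ℂ) := by fun_prop
  -- Any decay exponent `a > 1` would do; `b = 0` records boundedness of `exp (-t)` near `0`.
  have hmain := mellin_hasDerivAt_of_isBigO_rpow (E := ℂ) (a := 2) (b := 0) (s := 1)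
    (f := fun t : ℝ => ((Real.exp (-t) : ℝ) : ℂ))
    (hc.continuousOn.locallyIntegrableOn measurableSet_Ioi)
    (by
      rw [← Asymptotics.isBigO_norm_left]
      simp_rw [Complex.norm_real, Asymptotics.isBigO_norm_left]
      simpa only [neg_one_mul] using (isLittleO_exp_neg_mul_rpow_atTop zero_lt_one _).isBigO)
    (by simp)
    (by
      simp_rw [neg_zero, Real.rpow_zero]
      refine Asymptotics.isBigO_const_of_tendsto (?_ : Tendsto _ _ (𝓝 (1 : ℂ))) one_ne_zero
      have := (hc.tendsto 0).mono_left (nhdsWithin_le_nhds (s := Set.Ioi 0))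
      simpa using this)
    (by simp)
  rw [← Complex.GammaIntegral_eq_mellin] at hmain
  obtain ⟨h1, h2⟩ := hmain
  have hcongr : ∀ t : ℝ, (t : ℂ) ^ ((1 : ℂ) - 1) • (Real.log t • ((Real.exp (-t) : ℝ) : ℂ)) =
      ((Real.exp (-t) * Real.log t : ℝ) : ℂ) := fun t => by
    simp [mul_comm]
  have hint : IntegrableOn (fun t : ℝ => Real.exp (-t) * Real.log t) (Set.Ioi 0) := by
    unfold MellinConvergent at h1
    simp_rw [hcongr] at h1
    exact h1.re
  refine ⟨hint, ?_⟩
  have h3 : HasDerivAt Complex.Gamma (mellin (fun t : ℝ => Real.log t •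
      ((Real.exp (-t) : ℝ) : ℂ)) 1) 1 := by
    refine h2.congr_of_eventuallyEq ?_
    filter_upwards [(Complex.continuous_re.isOpen_preimage _ isOpen_Ioi).mem_nhds
      (show (1 : ℂ) ∈ Complex.re ⁻¹' Set.Ioi 0 by simp)] with s hs
    exact Complex.Gamma_eq_integral hs
  have h4 := h3.unique Complex.hasDerivAt_Gamma_one
  unfold mellin at h4
  simp_rw [hcongr] at h4
  rw [integral_complex_ofReal] at h4
  exact_mod_cast h4

theorem integrable_log_sq_norm :
    Integrable (fun z => Real.log (‖z‖ ^ 2)) (complexGaussian 1) :=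
  integrable_comp_sq_norm_complexGaussian integrableOn_exp_neg_mul_log_and_integral.1

theorem integral_log_sq_norm :
    ∫ z, Real.log (‖z‖ ^ 2) ∂complexGaussian 1 = -Real.eulerMascheroniConstant := by
  rw [integral_comp_sq_norm_complexGaussian Real.measurable_log,
    integrableOn_exp_neg_mul_log_and_integral.2]

/-- The density depends only on the modulus. Rotation by `-1` kills odd moments, rotation by `I`
equates real and imaginary second moments, and in the lower bound a rotation aligns the input with
the linear output. -/
theorem map_mul_complexGaussian_of_norm_eq_one {u : ℂ} (hu : ‖u‖ = 1) :
    (complexGaussian 1).map (fun z => u * z) = complexGaussian 1 := by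
  refine Measure.ext_of_lintegral _ fun F hF => ?_
  rw [lintegral_map hF (by fun_prop), complexGaussian_one_eq_toNNReal,
    lintegral_complexGaussian one_pos (by fun_prop), lintegral_complexGaussian one_pos hF]
  have hmp := (rotation ⟨u, mem_sphere_zero_iff_norm.2 hu⟩).measurePreserving
  conv_rhs => rw [← hmp.lintegral_comp (by fun_prop)]
  refine lintegral_congr fun z => ?_
  simp only [complexGaussianPDFReal, LinearIsometryEquiv.norm_map]
  rfl

theorem map_ofReal_mul_complexGaussian {v : ℝ} (hv : 0 ≤ v) :
    (complexGaussian 1).map (fun z => ((√v : ℝ) : ℂ) * z) = complexGaussian v.toNNReal := by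
  have h1 : (fun z => ((√v : ℝ) : ℂ) * z) ∘ (fun p : ℝ × ℝ => (⟨p.1, p.2⟩ : ℂ)) =
      (fun p : ℝ × ℝ => (⟨p.1, p.2⟩ : ℂ)) ∘ Prod.map (√v * ·) (√v * ·) := by
    ext p
    apply Complex.ext <;> simp
  have hm : Measurable (fun p : ℝ × ℝ => (⟨p.1, p.2⟩ : ℂ)) :=
    Complex.measurableEquivRealProd.symm.measurable
  unfold complexGaussian
  rw [Measure.map_map (by fun_prop) hm, h1, ← Measure.map_map hm (by fun_prop),
    ← Measure.map_prod_map _ _ (by fun_prop) (by fun_prop), gaussianReal_map_const_mul, mul_zero]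
  congr 3 <;>
  · ext
    simp [Real.sq_sqrt hv, Real.coe_toNNReal _ hv]
    ring

theorem integral_complexGaussian_toNNReal {v : ℝ} (hv : 0 ≤ v) (f : ℂ → ℝ) (hf : Measurable f) :
    ∫ z, f z ∂complexGaussian v.toNNReal = ∫ z, f (((√v : ℝ) : ℂ) * z) ∂complexGaussian 1 := by
  rw [← map_ofReal_mul_complexGaussian hv,
    integral_map (by fun_prop) hf.aestronglyMeasurable]

theorem integrable_complexGaussian_toNNReal {v : ℝ} (hv : 0 ≤ v) {f : ℂ → ℝ} (hf : Measurable f)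
    (h : Integrable (fun z => f (((√v : ℝ) : ℂ) * z)) (complexGaussian 1)) :
    Integrable f (complexGaussian v.toNNReal) := by
  rw [← map_ofReal_mul_complexGaussian hv]
  exact (integrable_map_measure hf.aestronglyMeasurable (by fun_prop)).2 h

theorem integral_comp_mul_of_norm_eq_one {u : ℂ} (hu : ‖u‖ = 1) {f : ℂ → ℝ} (hf : Measurable f) :
    ∫ z, f (u * z) ∂complexGaussian 1 = ∫ z, f z ∂complexGaussian 1 := by
  conv_rhs => rw [← map_mul_complexGaussian_of_norm_eq_one hu]
  rw [integral_map (by fun_prop) hf.aestronglyMeasurable]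

theorem integral_eq_zero_of_odd {f : ℂ → ℝ} (hf : Measurable f) (hodd : ∀ z, f (-z) = -f z) :
    ∫ z, f z ∂complexGaussian 1 = 0 := by
  have h := integral_comp_mul_of_norm_eq_one (u := -1) (by simp) hf
  simp only [neg_one_mul, hodd, integral_neg] at h
  linarith

theorem integrable_sq_norm : Integrable (fun z : ℂ => ‖z‖ ^ 2) (complexGaussian 1) := by
  simpa using integrable_sq_norm_pow 1

theorem integral_sq_norm : ∫ z : ℂ, ‖z‖ ^ 2 ∂complexGaussian 1 = 1 := by
  simpa using integral_sq_norm_pow 1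

theorem sq_re_add_sq_im (w : ℂ) : w.re ^ 2 + w.im ^ 2 = ‖w‖ ^ 2 := by
  rw [Complex.sq_norm, Complex.normSq_apply]; ring

theorem sq_re_mul_le (z m : ℂ) : (z * m).re ^ 2 ≤ ‖m‖ ^ 2 * ‖z‖ ^ 2 := by
  have := sq_re_add_sq_im (z * m)
  rw [norm_mul, mul_pow] at this
  nlinarith [sq_nonneg (z * m).im]

theorem sq_im_mul_le (z m : ℂ) : (z * m).im ^ 2 ≤ ‖m‖ ^ 2 * ‖z‖ ^ 2 := by
  have := sq_re_add_sq_im (z * m)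
  rw [norm_mul, mul_pow] at this
  nlinarith [sq_nonneg (z * m).re]

theorem integrable_sq_re_mul (m : ℂ) :
    Integrable (fun z : ℂ => (z * m).re ^ 2) (complexGaussian 1) := by
  refine (integrable_sq_norm.const_mul (‖m‖ ^ 2)).mono' (by fun_prop) (ae_of_all _ fun z => ?_)
  rw [Real.norm_of_nonneg (sq_nonneg _)]
  exact sq_re_mul_le z m

theorem integrable_sq_im_mul (m : ℂ) :
    Integrable (fun z : ℂ => (z * m).im ^ 2) (complexGaussian 1) := by
  refine (integrable_sq_norm.const_mul (‖m‖ ^ 2)).mono' (by fun_prop) (ae_of_all _ fun z => ?_)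
  rw [Real.norm_of_nonneg (sq_nonneg _)]
  exact sq_im_mul_le z m

/-- Rotation by `I` exchanges the squared real and imaginary parts, so each has half the mean of `‖z
* m‖ ^ 2`. -/
theorem integral_sq_re_mul (m : ℂ) :
    ∫ z : ℂ, (z * m).re ^ 2 ∂complexGaussian 1 = ‖m‖ ^ 2 / 2 := by
  have h1 := integral_comp_mul_of_norm_eq_one (u := Complex.I) (by simp)
    (f := fun z : ℂ => (z * m).re ^ 2) (by fun_prop)
  have h2 : ∀ z : ℂ, (Complex.I * z * m).re ^ 2 = (z * m).im ^ 2 := fun z => by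
    rw [mul_assoc, Complex.I_mul_re]; ring
  simp only [h2] at h1
  have h3 := integral_add (integrable_sq_re_mul m) (integrable_sq_im_mul m)
  simp only [sq_re_add_sq_im, norm_mul, mul_pow] at h3
  rw [integral_mul_const, integral_sq_norm] at h3
  linarith

theorem integral_sq_im_mul (m : ℂ) :
    ∫ z : ℂ, (z * m).im ^ 2 ∂complexGaussian 1 = ‖m‖ ^ 2 / 2 := by
  have h := integral_sq_re_mul (m * Complex.I)
  simp only [← mul_assoc, Complex.mul_I_re, neg_sq] at h
  simpa using h

/-- The deviation from its mean of the squared modulus of a Gaussian variable with mean `conj m`. -/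
theorem integrable_deviation_one (m : ℂ) :
    Integrable (fun z : ℂ => 2 * (z * m).re + (‖z‖ ^ 2 - 1)) (complexGaussian 1) := by
  have h1 : Integrable (fun z : ℂ => (z * m).re) (complexGaussian 1) := by
    refine ((integrable_sq_re_mul m).add (integrable_const 1)).mono' (by fun_prop)
      (ae_of_all _ fun z => ?_)
    simp only [Real.norm_eq_abs, Pi.add_apply]
    rw [abs_le]
    constructor <;> nlinarith [sq_nonneg ((z * m).re + 1), sq_nonneg ((z * m).re - 1)]
  exact (h1.const_mul 2).add (integrable_sq_norm.sub (integrable_const 1))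

theorem integrable_sq_sq_norm_sub_one :
    Integrable (fun z : ℂ => (‖z‖ ^ 2 - 1) ^ 2) (complexGaussian 1) := by
  have h2 := ((integrable_sq_norm_pow 2).sub (integrable_sq_norm.const_mul 2)).add
    (integrable_const 1)
  refine h2.congr (ae_of_all _ fun z => ?_)
  simp only [Pi.add_apply, Pi.sub_apply]
  ring

theorem integral_sq_sq_norm_sub_one :
    ∫ z : ℂ, (‖z‖ ^ 2 - 1) ^ 2 ∂complexGaussian 1 = 1 := by
  have h : ∀ z : ℂ, (‖z‖ ^ 2 - 1) ^ 2 = (‖z‖ ^ 2) ^ 2 - 2 * ‖z‖ ^ 2 + 1 := fun z => by ring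
  simp_rw [h]
  rw [integral_add (f := fun z : ℂ => (‖z‖ ^ 2) ^ 2 - 2 * ‖z‖ ^ 2)
    ((integrable_sq_norm_pow 2).sub (integrable_sq_norm.const_mul 2))
    (integrable_const 1), integral_sub (integrable_sq_norm_pow 2) (integrable_sq_norm.const_mul 2),
    integral_const_mul, integral_sq_norm, integral_sq_norm_pow]
  simp [Nat.factorial]

theorem integrable_re_mul_mul_sq_norm_sub_one (m : ℂ) :
    Integrable (fun z : ℂ => (z * m).re * (‖z‖ ^ 2 - 1)) (complexGaussian 1) := by
  refine ((integrable_sq_re_mul m).add integrable_sq_sq_norm_sub_one).mono' (by fun_prop)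
    (ae_of_all _ fun z => ?_)
  simp only [Real.norm_eq_abs, Pi.add_apply]
  rw [abs_le]
  constructor <;> nlinarith [sq_nonneg ((z * m).re + (‖z‖ ^ 2 - 1)),
    sq_nonneg ((z * m).re - (‖z‖ ^ 2 - 1)), sq_nonneg (z * m).re, sq_nonneg (‖z‖ ^ 2 - 1)]

theorem sq_deviation_one (m z : ℂ) : (2 * (z * m).re + (‖z‖ ^ 2 - 1)) ^ 2 =
    4 * (z * m).re ^ 2 + 4 * ((z * m).re * (‖z‖ ^ 2 - 1)) + (‖z‖ ^ 2 - 1) ^ 2 := by ring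

theorem integrable_sq_deviation_one (m : ℂ) :
    Integrable (fun z : ℂ => (2 * (z * m).re + (‖z‖ ^ 2 - 1)) ^ 2) (complexGaussian 1) := by
  simp_rw [sq_deviation_one]
  exact (((integrable_sq_re_mul m).const_mul 4).add
    ((integrable_re_mul_mul_sq_norm_sub_one m).const_mul 4)).add integrable_sq_sq_norm_sub_one

/-- The cross term is odd in `z`, the linear part contributes `4 * (‖m‖ ^ 2 / 2)`, and `‖z‖ ^ 2` has
variance `1`, being exponential. -/
theorem integral_sq_deviation_one (m : ℂ) :
    ∫ z : ℂ, (2 * (z * m).re + (‖z‖ ^ 2 - 1)) ^ 2 ∂complexGaussian 1 = 2 * ‖m‖ ^ 2 + 1 := by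
  simp_rw [sq_deviation_one]
  rw [integral_add (f := fun z : ℂ => 4 * (z * m).re ^ 2 + 4 * ((z * m).re * (‖z‖ ^ 2 - 1)))
      (((integrable_sq_re_mul m).const_mul 4).add
      ((integrable_re_mul_mul_sq_norm_sub_one m).const_mul 4)) integrable_sq_sq_norm_sub_one,
    integral_add ((integrable_sq_re_mul m).const_mul 4)
      ((integrable_re_mul_mul_sq_norm_sub_one m).const_mul 4),
    integral_const_mul, integral_const_mul, integral_sq_re_mul, integral_sq_sq_norm_sub_one,
    integral_eq_zero_of_odd (by fun_prop) (fun z => by simp; ring)]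
  ring

theorem integral_deviation_one (m : ℂ) :
    ∫ z : ℂ, (2 * (z * m).re + (‖z‖ ^ 2 - 1)) ∂complexGaussian 1 = 0 := by
  have h1 : Integrable (fun z : ℂ => 2 * (z * m).re) (complexGaussian 1) := by
    refine ((integrable_deviation_one m).sub
      (integrable_sq_norm.sub (integrable_const 1))).congr (ae_of_all _ fun z => ?_)
    simp
  rw [integral_add (g := fun z : ℂ => ‖z‖ ^ 2 - 1) h1
      (integrable_sq_norm.sub (integrable_const 1)),
    integral_eq_zero_of_odd (by fun_prop) (fun z => by simp; ring),
    integral_sub integrable_sq_norm (integrable_const 1), integral_sq_norm]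
  simp

/-- Reduces variance `s` to variance `1`, with `m` replaced by `m / √s`. -/
theorem deviation_scale {s : ℝ} (hs : 0 < s) (m z : ℂ) :
    2 * (((√s : ℝ) : ℂ) * z * m).re + (‖((√s : ℝ) : ℂ) * z‖ ^ 2 - s) =
      s * (2 * (z * (((√s)⁻¹ : ℝ) * m)).re + (‖z‖ ^ 2 - 1)) := by
  have h1 : √s ≠ 0 := (Real.sqrt_pos.2 hs).ne'
  have h2 : (((√s : ℝ) : ℂ) * z * m).re = √s * (z * m).re := by
    rw [mul_assoc, Complex.re_ofReal_mul]
  have h3 : (z * (((√s)⁻¹ : ℝ) * m)).re = (√s)⁻¹ * (z * m).re := by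
    rw [mul_left_comm, Complex.re_ofReal_mul]
  have h4 : s * (√s)⁻¹ = √s := by
    rw [← div_eq_mul_inv, Real.div_sqrt]
  rw [h2, h3, norm_mul, mul_pow, Complex.norm_real, Real.norm_eq_abs, sq_abs, Real.sq_sqrt hs.le]
  linear_combination (-2 * (z * m).re) * h4

theorem integrable_deviation {s : ℝ} (hs : 0 < s) (m : ℂ) :
    Integrable (fun z : ℂ => 2 * (z * m).re + (‖z‖ ^ 2 - s)) (complexGaussian s.toNNReal) := by
  refine integrable_complexGaussian_toNNReal hs.le (by fun_prop) ?_
  simp_rw [deviation_scale hs]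
  exact (integrable_deviation_one _).const_mul _

theorem integral_deviation {s : ℝ} (hs : 0 < s) (m : ℂ) :
    ∫ z : ℂ, (2 * (z * m).re + (‖z‖ ^ 2 - s)) ∂complexGaussian s.toNNReal = 0 := by
  rw [integral_complexGaussian_toNNReal hs.le _ (by fun_prop)]
  simp_rw [deviation_scale hs]
  rw [integral_const_mul, integral_deviation_one, mul_zero]

theorem integrable_sq_deviation {s : ℝ} (hs : 0 < s) (m : ℂ) :
    Integrable (fun z : ℂ => (2 * (z * m).re + (‖z‖ ^ 2 - s)) ^ 2)
      (complexGaussian s.toNNReal) := by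
  refine integrable_complexGaussian_toNNReal hs.le (by fun_prop) ?_
  simp_rw [deviation_scale hs, mul_pow]
  exact (integrable_sq_deviation_one _).const_mul _

theorem integral_sq_deviation {s : ℝ} (hs : 0 < s) (m : ℂ) :
    ∫ z : ℂ, (2 * (z * m).re + (‖z‖ ^ 2 - s)) ^ 2 ∂complexGaussian s.toNNReal =
      s ^ 2 + 2 * s * ‖m‖ ^ 2 := by
  rw [integral_complexGaussian_toNNReal hs.le _ (by fun_prop)]
  simp_rw [deviation_scale hs, mul_pow]
  rw [integral_const_mul, integral_sq_deviation_one, norm_mul, mul_pow, Complex.norm_real,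
    Real.norm_eq_abs, sq_abs, inv_pow, Real.sq_sqrt hs.le]
  field_simp
  ring

theorem integrable_sq_norm_complexGaussian {v : ℝ} (hv : 0 ≤ v) :
    Integrable (fun z : ℂ => ‖z‖ ^ 2) (complexGaussian v.toNNReal) := by
  refine integrable_complexGaussian_toNNReal hv (by fun_prop) ?_
  simp_rw [norm_mul, mul_pow]
  exact integrable_sq_norm.const_mul _

theorem integral_sq_norm_complexGaussian {v : ℝ} (hv : 0 ≤ v) :
    ∫ z : ℂ, ‖z‖ ^ 2 ∂complexGaussian v.toNNReal = v := by
  rw [integral_complexGaussian_toNNReal hv _ (by fun_prop)]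
  simp_rw [norm_mul, mul_pow]
  rw [integral_const_mul, integral_sq_norm, Complex.norm_real, Real.norm_eq_abs, sq_abs,
    Real.sq_sqrt hv, mul_one]

end Moments

/-! ### Adding the real noise of the power branch -/

section RealGaussian

theorem lintegral_gaussianReal {v : ℝ} (hv : 0 < v) {F : ℝ → ℝ≥0∞} (hF : Measurable F) :
    ∫⁻ n, F n ∂gaussianReal 0 v.toNNReal =
      ∫⁻ n, ENNReal.ofReal (gaussianPDFReal 0 v.toNNReal n) * F n := by
  rw [gaussianReal_of_var_ne_zero _ (Real.toNNReal_pos.2 hv).ne',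
    lintegral_withDensity_eq_lintegral_mul _ (measurable_gaussianPDF _ _) hF]
  rfl

theorem integrable_id_gaussian (v : ℝ≥0) : Integrable (fun n : ℝ => n) (gaussianReal 0 v) :=
  (memLp_id_gaussianReal 1).integrable le_rfl

theorem integrable_sq_gaussian (v : ℝ≥0) : Integrable (fun n : ℝ => n ^ 2) (gaussianReal 0 v) :=
  (memLp_id_gaussianReal 2).integrable_sq

theorem integral_sq_gaussian {v : ℝ} (hv : 0 ≤ v) :
    ∫ n, n ^ 2 ∂gaussianReal 0 v.toNNReal = v := by
  have h := variance_eq_sub (memLp_id_gaussianReal (μ := 0) (v := v.toNNReal) 2)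
  rw [variance_id_gaussianReal] at h
  simp only [id, Pi.pow_apply, integral_id_gaussianReal, Real.coe_toNNReal _ hv] at h
  linarith

theorem integrable_sq_mul_deviation_add {s v : ℝ} (hs : 0 < s) (k : ℝ) (m : ℂ) :
    Integrable (fun p : ℂ × ℝ => (k * (2 * (p.1 * m).re + (‖p.1‖ ^ 2 - s)) + p.2) ^ 2)
      ((complexGaussian s.toNNReal).prod (gaussianReal 0 v.toNNReal)) := by
  have h1 := ((integrable_sq_deviation hs m).const_mul (k ^ 2)).comp_fst
    (gaussianReal 0 v.toNNReal)
  have h2 := ((integrable_deviation hs m).mul_prod (integrable_id_gaussian v.toNNReal)).const_mul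
    (2 * k)
  have h3 := (integrable_sq_gaussian v.toNNReal).comp_snd (complexGaussian s.toNNReal)
  refine ((h1.add h2).add h3).congr (ae_of_all _ fun p => ?_)
  simp only [Pi.add_apply]
  ring

/-- This is the conditional variance of the power output given the linear output. The cross term
vanishes by independence, the deviation having mean zero. -/
theorem integral_sq_mul_deviation_add {s v : ℝ} (hs : 0 < s) (hv : 0 ≤ v) (k : ℝ) (m : ℂ) :
    ∫ p : ℂ × ℝ, (k * (2 * (p.1 * m).re + (‖p.1‖ ^ 2 - s)) + p.2) ^ 2
      ∂((complexGaussian s.toNNReal).prod (gaussianReal 0 v.toNNReal)) =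
    v + k ^ 2 * (s ^ 2 + 2 * s * ‖m‖ ^ 2) := by
  have h1 := ((integrable_sq_deviation hs m).const_mul (k ^ 2)).comp_fst
    (gaussianReal 0 v.toNNReal)
  have h2 := ((integrable_deviation hs m).mul_prod (integrable_id_gaussian v.toNNReal)).const_mul
    (2 * k)
  have h3 := (integrable_sq_gaussian v.toNNReal).comp_snd (complexGaussian s.toNNReal)
  have h : ∀ p : ℂ × ℝ, (k * (2 * (p.1 * m).re + (‖p.1‖ ^ 2 - s)) + p.2) ^ 2 =
      k ^ 2 * (2 * (p.1 * m).re + (‖p.1‖ ^ 2 - s)) ^ 2 +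
        2 * k * ((2 * (p.1 * m).re + (‖p.1‖ ^ 2 - s)) * p.2) + p.2 ^ 2 := fun p => by ring
  simp_rw [h]
  rw [integral_add (f := fun p : ℂ × ℝ => k ^ 2 * (2 * (p.1 * m).re + (‖p.1‖ ^ 2 - s)) ^ 2 +
        2 * k * ((2 * (p.1 * m).re + (‖p.1‖ ^ 2 - s)) * p.2)) (h1.add h2) h3,
    integral_add h1 h2,
    integral_fun_fst (f := fun z : ℂ => k ^ 2 * (2 * (z * m).re + (‖z‖ ^ 2 - s)) ^ 2),
    integral_fun_snd (f := fun n : ℝ => n ^ 2), integral_const_mul, integral_const_mul,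
    integral_prod_mul (fun z : ℂ => 2 * (z * m).re + (‖z‖ ^ 2 - s)) (fun n : ℝ => n),
    integral_sq_deviation hs, integral_deviation hs, integral_sq_gaussian hv]
  simp
  ring

end RealGaussian

/-! ### The channel: joint law, transition density, estimation error -/

section Channel

variable {Ω : Type*} [MeasurableSpace Ω] {μ : Measure Ω}
  {X Z : Ω → ℂ} {N : Ω → ℝ} {σ ς : ℝ}

/-- The joint law of input and noises. -/
def IsGaussianChannel (μ : Measure Ω) (X Z : Ω → ℂ) (N : Ω → ℝ) (σ ς : ℝ) : Prop :=
  HasLaw (fun ω => (X ω, (Z ω, N ω)))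
    ((complexGaussian 1).prod ((complexGaussian σ.toNNReal).prod (gaussianReal 0 ς.toNNReal))) μ

/-- The conditional density of the output given the input, for gain `α` of the linear branch and
`k` of the power branch. -/
noncomputable def transitionDensity (α k σ ς : ℝ) (p : ℂ × ℂ × ℝ) : ℝ :=
  complexGaussianPDFReal σ (p.2.1 - (α : ℂ) * p.1) *
    gaussianPDFReal 0 ς.toNNReal (p.2.2 - k * ‖p.1‖ ^ 2)

@[fun_prop]
theorem measurable_transitionDensity (α k σ ς : ℝ) : Measurable (transitionDensity α k σ ς) := by
  unfold transitionDensity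
  have := measurable_gaussianPDFReal 0 ς.toNNReal
  fun_prop

theorem transitionDensity_pos (α k : ℝ) (hσ : 0 < σ) (hς : 0 < ς) (p : ℂ × ℂ × ℝ) :
    0 < transitionDensity α k σ ς p :=
  mul_pos (complexGaussianPDFReal_pos hσ _)
    (gaussianPDFReal_pos _ _ _ (Real.toNNReal_pos.2 hς).ne')

theorem IsGaussianChannel.map_eq_withDensity (h : IsGaussianChannel μ X Z N σ ς) (hσ : 0 < σ)
    (hς : 0 < ς) (α k : ℝ) :
    μ.map (fun ω => (X ω, ((α : ℂ) * X ω + Z ω, k * ‖X ω‖ ^ 2 + N ω))) =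
      ((complexGaussian 1).prod (volume.prod volume)).withDensity
        fun p => ENNReal.ofReal (transitionDensity α k σ ς p) := by
  have hgm := measurable_gaussianPDFReal 0 ς.toNNReal
  have hT : Measurable fun p : ℂ × ℂ × ℝ =>
      (p.1, ((α : ℂ) * p.1 + p.2.1, k * ‖p.1‖ ^ 2 + p.2.2)) := by fun_prop
  have hlaw : μ.map (fun ω => (X ω, ((α : ℂ) * X ω + Z ω, k * ‖X ω‖ ^ 2 + N ω))) =
      ((complexGaussian 1).prod
        ((complexGaussian σ.toNNReal).prod (gaussianReal 0 ς.toNNReal))).map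
        fun p : ℂ × ℂ × ℝ => (p.1, ((α : ℂ) * p.1 + p.2.1, k * ‖p.1‖ ^ 2 + p.2.2)) := by
    rw [← h.map_eq, AEMeasurable.map_map_of_aemeasurable hT.aemeasurable h.aemeasurable]
    rfl
  refine Measure.ext_of_lintegral _ fun F hF => ?_
  rw [hlaw, lintegral_map hF hT, lintegral_withDensity_eq_lintegral_mul _ (by fun_prop) hF,
    lintegral_prod _ (by fun_prop), lintegral_prod _ (by fun_prop)]
  refine lintegral_congr fun x => ?_
  rw [lintegral_prod _ (by fun_prop), lintegral_prod _ (by fun_prop),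
    lintegral_complexGaussian hσ (by fun_prop)]
  conv_rhs => rw [← lintegral_add_left_eq_self _ ((α : ℂ) * x)]
  refine lintegral_congr fun z => ?_
  rw [lintegral_gaussianReal hς (by fun_prop), ← lintegral_const_mul _ (by fun_prop)]
  conv_rhs => rw [← lintegral_add_left_eq_self _ (k * ‖x‖ ^ 2)]
  refine lintegral_congr fun n => ?_
  simp only [Pi.mul_apply, transitionDensity, add_sub_cancel_left]
  rw [ENNReal.ofReal_mul (complexGaussianPDFReal_pos hσ _).le, mul_assoc]

theorem IsGaussianChannel.hasLaw_input (h : IsGaussianChannel μ X Z N σ ς) :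
    HasLaw X (complexGaussian 1) μ := by
  have := (measurePreserving_fst (μ := complexGaussian 1)
    (ν := (complexGaussian σ.toNNReal).prod (gaussianReal 0 ς.toNNReal))).comp_hasLaw h
  exact this

theorem IsGaussianChannel.hasLaw_linear_noise (h : IsGaussianChannel μ X Z N σ ς) :
    HasLaw Z (complexGaussian σ.toNNReal) μ := by
  have := (measurePreserving_fst.comp (measurePreserving_snd (μ := complexGaussian 1)
    (ν := (complexGaussian σ.toNNReal).prod (gaussianReal 0 ς.toNNReal)))).comp_hasLaw h
  exact this

theorem IsGaussianChannel.hasLaw_power_noise (h : IsGaussianChannel μ X Z N σ ς) :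
    HasLaw N (gaussianReal 0 ς.toNNReal) μ := by
  have := (measurePreserving_snd.comp (measurePreserving_snd (μ := complexGaussian 1)
    (ν := (complexGaussian σ.toNNReal).prod (gaussianReal 0 ς.toNNReal)))).comp_hasLaw h
  exact this

theorem IsGaussianChannel.hasLaw_input_linear_noise (h : IsGaussianChannel μ X Z N σ ς) :
    HasLaw (fun ω => (X ω, Z ω)) ((complexGaussian 1).prod (complexGaussian σ.toNNReal)) μ := by
  have := (measurePreserving_fst.comp (measurePreserving_prodAssoc (complexGaussian 1)
    (complexGaussian σ.toNNReal) (gaussianReal 0 ς.toNNReal)).symm).comp_hasLaw h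
  exact this

/-- The linear output, the error of the linear estimate of the input and the power-detection noise
are independent. -/
theorem IsGaussianChannel.hasLaw_estimate (h : IsGaussianChannel μ X Z N σ ς) (hσ : 0 < σ)
    (α : ℝ) {τ : ℝ} (hτ : τ = α ^ 2 + σ) :
    HasLaw (fun ω => ((α : ℂ) * X ω + Z ω,
        (X ω - ((α / τ : ℝ) : ℂ) * ((α : ℂ) * X ω + Z ω), N ω)))
      ((complexGaussian τ.toNNReal).prod
        ((complexGaussian (σ / τ).toNNReal).prod (gaussianReal 0 ς.toNNReal))) μ := by
  have h1 : MeasurePreserving (fun p : ℂ × ℂ => ((α : ℂ) * p.1 + p.2,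
      p.1 - ((α / τ : ℝ) : ℂ) * ((α : ℂ) * p.1 + p.2)))
      ((complexGaussian 1).prod (complexGaussian σ.toNNReal))
      ((complexGaussian τ.toNNReal).prod (complexGaussian (σ / τ).toNNReal)) :=
    ⟨by fun_prop, map_prod_complexGaussian α hσ hτ⟩
  have h2 := h1.prod (MeasurePreserving.id (gaussianReal 0 ς.toNNReal))
  have h3 := ((measurePreserving_prodAssoc _ _ _).comp (h2.comp
    (measurePreserving_prodAssoc (complexGaussian 1) (complexGaussian σ.toNNReal)
      (gaussianReal 0 ς.toNNReal)).symm)).comp_hasLaw h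
  exact h3

end Channel

/-! ### Upper bound from a moment-matched output density -/

section UpperBound

open InformationTheory

variable {Ω : Type*} [MeasurableSpace Ω] {μ : Measure Ω}
  {X Z : Ω → ℂ} {N : Ω → ℝ} {σ ς : ℝ}

/-- An upper bound, in nats, on the information of a channel whose branches have signal to noise
ratios `a` and `b`. -/
noncomputable def informationBound (a b : ℝ) : ℝ :=
  1 / 2 * ∫ w : ℂ, Real.log ((1 + a) ^ 2 + b * (1 + 2 * a * ‖w‖ ^ 2)) ∂complexGaussian 1

theorem integrable_log_affine_sq_norm {A B : ℝ} (hA : 0 < A) (hB : 0 ≤ B) :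
    Integrable (fun w : ℂ => Real.log (A + B * ‖w‖ ^ 2)) (complexGaussian 1) := by
  refine ((integrable_const |Real.log A|).add (integrable_sq_norm.const_mul (B / A))).mono'
    -- The domination is `|log (A + B x)| ≤ |log A| + B x / A`, from `log (1 + u) ≤ u`.
    (Measurable.aestronglyMeasurable (by fun_prop)) (ae_of_all _ fun w => ?_)
  have h0 : 0 ≤ B / A * ‖w‖ ^ 2 := by positivity
  have h1 : A + B * ‖w‖ ^ 2 = A * (1 + B / A * ‖w‖ ^ 2) := by field_simp
  have h2 := Real.log_le_sub_one_of_pos (show 0 < 1 + B / A * ‖w‖ ^ 2 by positivity)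
  have h3 : 0 ≤ Real.log (1 + B / A * ‖w‖ ^ 2) := Real.log_nonneg (by linarith)
  rw [h1, Real.log_mul hA.ne' (by positivity), Real.norm_eq_abs]
  refine (abs_add_le _ _).trans ?_
  rw [abs_of_nonneg h3]
  simp only [Pi.add_apply]
  linarith

/-- The conditional mean of the output of the power branch given that of the linear branch. -/
noncomputable def powerMean (k c s : ℝ) (y : ℂ) : ℝ := k * (‖(c : ℂ) * y‖ ^ 2 + s)

/-- The conditional variance of the output of the power branch given that of the linear branch. -/
noncomputable def powerVariance (k c s ς : ℝ) (y : ℂ) : ℝ :=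
  ς + k ^ 2 * (s ^ 2 + 2 * s * ‖(c : ℂ) * y‖ ^ 2)

@[fun_prop]
theorem measurable_powerMean (k c s : ℝ) : Measurable (powerMean k c s) := by
  unfold powerMean; fun_prop

@[fun_prop]
theorem measurable_powerVariance (k c s ς : ℝ) : Measurable (powerVariance k c s ς) := by
  unfold powerVariance; fun_prop

theorem powerVariance_pos (k c : ℝ) {s : ℝ} (hs : 0 ≤ s) (hς : 0 < ς) (y : ℂ) :
    0 < powerVariance k c s ς y := by
  unfold powerVariance; positivity

/-- An output density: the law of the output of the linear branch, and a Gaussian conditional law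
with the right mean and variance for the output of the power branch. -/
noncomputable def testOutputDensity (k c s τ ς : ℝ) (y : ℂ × ℝ) : ℝ :=
  complexGaussianPDFReal τ y.1 *
    gaussianPDFReal (powerMean k c s y.1) (powerVariance k c s ς y.1).toNNReal y.2

theorem measurable_testOutputDensity (k c s τ ς : ℝ) :
    Measurable (testOutputDensity k c s τ ς) := by
  have h : Measurable fun y : ℂ × ℝ =>
      gaussianPDFReal (powerMean k c s y.1) (powerVariance k c s ς y.1).toNNReal y.2 :=
    measurable_uncurry_gaussianPDFReal.comp
      (f := fun y : ℂ × ℝ =>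
        (powerMean k c s y.1, (powerVariance k c s ς y.1).toNNReal, y.2)) (by fun_prop)
  unfold testOutputDensity
  fun_prop

theorem lintegral_complexGaussianPDFReal {v : ℝ} (hv : 0 < v) :
    ∫⁻ z, ENNReal.ofReal (complexGaussianPDFReal v z) = 1 := by
  have h := lintegral_complexGaussian hv (F := fun _ => 1) measurable_const
  simpa using h.symm

theorem lintegral_testOutputDensity (k c : ℝ) {s τ : ℝ} (hs : 0 ≤ s) (hτ : 0 < τ) (hς : 0 < ς) :
    ∫⁻ y, ENNReal.ofReal (testOutputDensity k c s τ ς y) ∂(volume.prod volume) = 1 := by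
  have := measurable_testOutputDensity k c s τ ς
  rw [lintegral_prod _ (by fun_prop), ← lintegral_complexGaussianPDFReal hτ]
  refine lintegral_congr fun y => ?_
  simp only [testOutputDensity]
  simp_rw [ENNReal.ofReal_mul (complexGaussianPDFReal_pos hτ _).le]
  rw [lintegral_const_mul _ (measurable_gaussianPDFReal _ _).ennreal_ofReal,
    lintegral_gaussianPDFReal_eq_one _ (Real.toNNReal_pos.2 (powerVariance_pos k c hs hς y)).ne',
    mul_one]

/-- The logarithm of the ratio of the transition density to the test output density. -/
noncomputable def logDensityRatio (α k c s σ τ ς : ℝ) (p : ℂ × ℂ × ℝ) : ℝ :=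
  Real.log (τ / σ) - ‖p.2.1 - (α : ℂ) * p.1‖ ^ 2 / σ -
    (p.2.2 - k * ‖p.1‖ ^ 2) ^ 2 / (2 * ς) + ‖p.2.1‖ ^ 2 / τ +
    1 / 2 * Real.log (powerVariance k c s ς p.2.1 / ς) +
    (p.2.2 - powerMean k c s p.2.1) ^ 2 / (2 * powerVariance k c s ς p.2.1)

theorem transitionDensity_mul_exp_neg (α k c : ℝ) {s τ : ℝ} (hs : 0 ≤ s) (hσ : 0 < σ) (hτ : 0 < τ)
    (hς : 0 < ς) (p : ℂ × ℂ × ℝ) :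
    transitionDensity α k σ ς p * Real.exp (-logDensityRatio α k c s σ τ ς p) =
      testOutputDensity k c s τ ς p.2 := by
  have hV := powerVariance_pos k c hs hς p.2.1
  unfold transitionDensity testOutputDensity logDensityRatio complexGaussianPDFReal
    gaussianPDFReal
  rw [Real.coe_toNNReal _ hς.le, Real.coe_toNNReal _ hV.le]
  set V := powerVariance k c s ς p.2.1
  set A := ‖p.2.1 - (α : ℂ) * p.1‖ ^ 2 / σ with hA
  set B := (p.2.2 - k * ‖p.1‖ ^ 2) ^ 2 / (2 * ς) with hB
  set C := ‖p.2.1‖ ^ 2 / τ with hC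
  set D := (p.2.2 - powerMean k c s p.2.1) ^ 2 / (2 * V) with hD
  have h1 : Real.exp (-(Real.log (τ / σ) - A - B + C + 1 / 2 * Real.log (V / ς) + D)) =
      σ / τ * (√(V / ς))⁻¹ * (Real.exp A * Real.exp B * Real.exp (-C) * Real.exp (-D)) := by
    have h2 : 1 / 2 * Real.log (V / ς) = Real.log √(V / ς) := by
      rw [Real.log_sqrt (by positivity)]; ring
    rw [h2, ← Real.exp_add, ← Real.exp_add, ← Real.exp_add, ← Real.exp_log
      (show 0 < σ / τ * (√(V / ς))⁻¹ by positivity), ← Real.exp_add,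
      Real.log_mul (by positivity) (by positivity), Real.log_inv, Real.log_div hσ.ne' hτ.ne',
      Real.log_div hτ.ne' hσ.ne']
    congr 1
    ring
  have h2 : √(V / ς) = √(2 * Real.pi * V) / √(2 * Real.pi * ς) := by
    rw [← Real.sqrt_div (by positivity)]
    congr 1
    field_simp
  have hAe : Real.exp (-‖p.2.1 - (α : ℂ) * p.1‖ ^ 2 / σ) = (Real.exp A)⁻¹ := by
    rw [← Real.exp_neg, hA, neg_div]
  have hBe : Real.exp (-(p.2.2 - k * ‖p.1‖ ^ 2 - 0) ^ 2 / (2 * ς)) = (Real.exp B)⁻¹ := by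
    rw [← Real.exp_neg, hB, neg_div, sub_zero]
  rw [h1, h2, hAe, hBe, neg_div, neg_div, ← hC, ← hD]
  have := Real.exp_pos A
  have := Real.exp_pos B
  field_simp

theorem IsGaussianChannel.isProbabilityMeasure (h : IsGaussianChannel μ X Z N σ ς) :
    IsProbabilityMeasure μ :=
  h.isProbabilityMeasure_iff.2 inferInstance

/-- Write `y = √τ w` and absorb `log (τ / σ)` into the second logarithm as the factor `(τ / σ) ^ 2 =
(1 + α ^ 2 / σ) ^ 2`. -/
theorem informationBound_eq {α k τ : ℝ} (hσ : 0 < σ) (hς : 0 < ς) (hτ : τ = α ^ 2 + σ) :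
    Real.log (τ / σ) + 1 / 2 * ∫ y, Real.log (powerVariance k (α / τ) (σ / τ) ς y / ς)
      ∂complexGaussian τ.toNNReal = informationBound (α ^ 2 / σ) (k ^ 2 / ς) := by
  have hτ0 : 0 < τ := by rw [hτ]; positivity
  have hs : 0 < σ / τ := by positivity
  rw [integral_complexGaussian_toNNReal hτ0.le _ (by fun_prop), informationBound]
  have h1 : ∀ w : ℂ, Real.log ((1 + α ^ 2 / σ) ^ 2 + k ^ 2 / ς * (1 + 2 * (α ^ 2 / σ) * ‖w‖ ^ 2)) =
      2 * Real.log (τ / σ) +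
        Real.log (powerVariance k (α / τ) (σ / τ) ς (((√τ : ℝ) : ℂ) * w) / ς) := fun w => by
    have hV := powerVariance_pos k (α / τ) hs.le hς (((√τ : ℝ) : ℂ) * w)
    rw [← Nat.cast_ofNat (R := ℝ), ← Real.log_pow,
      ← Real.log_mul (by positivity) (by positivity)]
    congr 1
    simp only [powerVariance, norm_mul, mul_pow, Complex.norm_real, Real.norm_eq_abs, sq_abs,
      Real.sq_sqrt hτ0.le, Nat.cast_ofNat]
    have h2 : 1 + α ^ 2 / σ = τ / σ := by rw [hτ]; field_simp; ring
    rw [h2]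
    field_simp
  have hint : Integrable (fun w : ℂ =>
      Real.log (powerVariance k (α / τ) (σ / τ) ς (((√τ : ℝ) : ℂ) * w) / ς))
      (complexGaussian 1) := by
    refine ((integrable_log_affine_sq_norm (A := (1 + α ^ 2 / σ) ^ 2 + k ^ 2 / ς)
      (B := k ^ 2 / ς * (2 * (α ^ 2 / σ))) (by positivity) (by positivity)).sub
      (integrable_const (2 * Real.log (τ / σ)))).congr (ae_of_all _ fun w => ?_)
    have := h1 w
    simp only [Pi.sub_apply]
    rw [sub_eq_iff_eq_add', ← this]
    congr 1
    ring
  simp_rw [h1]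
  rw [integral_add (integrable_const _) hint]
  simp
  ring

theorem integrable_log_powerVariance {α τ : ℝ} (k : ℝ) (hσ : 0 < σ) (hς : 0 < ς)
    (hτ : 0 < τ) :
    Integrable (fun y => Real.log (powerVariance k (α / τ) (σ / τ) ς y / ς))
      (complexGaussian τ.toNNReal) := by
  refine integrable_complexGaussian_toNNReal hτ.le (by fun_prop) ?_
  refine (integrable_log_affine_sq_norm (A := (ς + k ^ 2 * (σ / τ) ^ 2) / ς)
    (B := k ^ 2 * (2 * (σ / τ) * (α / τ) ^ 2 * τ) / ς) (by positivity) (by positivity)).congr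
    (ae_of_all _ fun w => ?_)
  simp only [powerVariance, norm_mul, mul_pow, Complex.norm_real, Real.norm_eq_abs, sq_abs,
    Real.sq_sqrt hτ.le]
  congr 1
  ring

/-- The power output in terms of the linear output, the estimation error and the noise. -/
theorem power_output_sub_powerMean (k c s : ℝ) (x y : ℂ) (n : ℝ) :
    k * ‖x‖ ^ 2 + n - powerMean k c s y =
      k * (2 * ((x - (c : ℂ) * y) * (starRingEnd ℂ) ((c : ℂ) * y)).re +
        (‖x - (c : ℂ) * y‖ ^ 2 - s)) + n := by
  unfold powerMean
  simp only [Complex.sq_norm, Complex.normSq_apply, Complex.mul_re, Complex.conj_re,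
    Complex.conj_im, Complex.sub_re, Complex.sub_im]
  ring

/-- The squared deviation of the power output from its conditional mean, divided by the
conditional variance, as a function of the linear output, the estimation error and the noise. -/
noncomputable def normalizedSquare (k c s ς : ℝ) (p : ℂ × ℂ × ℝ) : ℝ :=
  (k * (2 * (p.2.1 * (starRingEnd ℂ) ((c : ℂ) * p.1)).re + (‖p.2.1‖ ^ 2 - s)) + p.2.2) ^ 2 /
    powerVariance k c s ς p.1

theorem measurable_normalizedSquare (k c s ς : ℝ) : Measurable (normalizedSquare k c s ς) := by
  have : Measurable (starRingEnd ℂ) := Complex.continuous_conj.measurable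
  unfold normalizedSquare
  fun_prop

/-- The test density uses the exact conditional variance, so the normalized square has mean `1` for
each `y` separately; the integrability on the product rests on this too. -/
theorem integral_normalizedSquare_right (k c : ℝ) {s : ℝ} (hs : 0 < s) (hς : 0 < ς) (y : ℂ) :
    ∫ p : ℂ × ℝ, normalizedSquare k c s ς (y, p)
      ∂((complexGaussian s.toNNReal).prod (gaussianReal 0 ς.toNNReal)) = 1 := by
  simp only [normalizedSquare]
  rw [integral_div, integral_sq_mul_deviation_add hs hς.le, RCLike.norm_conj]
  exact div_self (powerVariance_pos k c hs.le hς y).ne'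

theorem integrable_normalizedSquare (ν : Measure ℂ) [IsProbabilityMeasure ν] (k c : ℝ) {s : ℝ}
    (hs : 0 < s) (hς : 0 < ς) :
    Integrable (normalizedSquare k c s ς)
      (ν.prod ((complexGaussian s.toNNReal).prod (gaussianReal 0 ς.toNNReal))) := by
  have hnorm : ∀ p, ‖normalizedSquare k c s ς p‖ = normalizedSquare k c s ς p := fun p =>
    Real.norm_of_nonneg (div_nonneg (sq_nonneg _) (powerVariance_pos k c hs.le hς _).le)
  rw [integrable_prod_iff (measurable_normalizedSquare k c s ς).aestronglyMeasurable]
  refine ⟨ae_of_all _ fun y => ?_, ?_⟩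
  · simp only [normalizedSquare]
    exact (integrable_sq_mul_deviation_add hs k ((starRingEnd ℂ) ((c : ℂ) * y))).div_const _
  simp_rw [hnorm, integral_normalizedSquare_right k c hs hς]
  exact integrable_const 1

theorem integral_normalizedSquare (ν : Measure ℂ) [IsProbabilityMeasure ν] (k c : ℝ) {s : ℝ}
    (hs : 0 < s) (hς : 0 < ς) :
    ∫ p, normalizedSquare k c s ς p
      ∂(ν.prod ((complexGaussian s.toNNReal).prod (gaussianReal 0 ς.toNNReal))) = 1 := by
  rw [integral_prod _ (integrable_normalizedSquare ν k c hs hς)]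
  simp_rw [integral_normalizedSquare_right k c hs hς]
  simp

theorem _root_.ProbabilityTheory.HasLaw.integrable_comp {α : Type*} [MeasurableSpace α]
    {ν : Measure α} {U : Ω → α} (hU : HasLaw U ν μ) {f : α → ℝ} (hf : Integrable f ν) :
    Integrable (fun ω => f (U ω)) μ := by
  rw [← hU.map_eq] at hf
  exact hf.comp_aemeasurable hU.aemeasurable

/-- The four quadratic terms of `logDensityRatio` have means `-1`, `-1/2`, `1` and `1/2`. They
cancel and leave the logarithmic terms, which `informationBound_eq` collects. -/
theorem IsGaussianChannel.toReal_klDiv_le (h : IsGaussianChannel μ X Z N σ ς) (hσ : 0 < σ)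
    (hς : 0 < ς) (α k : ℝ) :
    klDiv (μ.map fun ω => (X ω, ((α : ℂ) * X ω + Z ω, k * ‖X ω‖ ^ 2 + N ω)))
        ((μ.map X).prod (μ.map fun ω => ((α : ℂ) * X ω + Z ω, k * ‖X ω‖ ^ 2 + N ω))) ≠ ⊤ ∧
      (klDiv (μ.map fun ω => (X ω, ((α : ℂ) * X ω + Z ω, k * ‖X ω‖ ^ 2 + N ω)))
        ((μ.map X).prod
          (μ.map fun ω => ((α : ℂ) * X ω + Z ω, k * ‖X ω‖ ^ 2 + N ω)))).toReal ≤
        informationBound (α ^ 2 / σ) (k ^ 2 / ς) := by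
  have := h.isProbabilityMeasure
  obtain ⟨τ, hτ⟩ : ∃ τ, τ = α ^ 2 + σ := ⟨_, rfl⟩
  have hτ0 : 0 < τ := by rw [hτ]; positivity
  have hs : 0 < σ / τ := by positivity
  have hXm : AEMeasurable X μ := h.hasLaw_input.aemeasurable
  have hZm : AEMeasurable Z μ := h.hasLaw_linear_noise.aemeasurable
  have hNm : AEMeasurable N μ := h.hasLaw_power_noise.aemeasurable
  have hVm : AEMeasurable (fun ω => ((α : ℂ) * X ω + Z ω, k * ‖X ω‖ ^ 2 + N ω)) μ := by fun_prop
  have hTm : AEMeasurable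
      (fun ω => (X ω, ((α : ℂ) * X ω + Z ω, k * ‖X ω‖ ^ 2 + N ω))) μ := hXm.prodMk hVm
  have hsnd : μ.map (fun ω => ((α : ℂ) * X ω + Z ω, k * ‖X ω‖ ^ 2 + N ω)) =
      (μ.map fun ω => (X ω, ((α : ℂ) * X ω + Z ω, k * ‖X ω‖ ^ 2 + N ω))).snd :=
    (Measure.snd_map_prodMk₀ hXm).symm
  have hgm : Measurable (logDensityRatio α k (α / τ) (σ / τ) σ τ ς) := by
    unfold logDensityRatio; fun_prop
  have hZ := h.hasLaw_linear_noise
  have hN := h.hasLaw_power_noise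
  have hE := h.hasLaw_estimate hσ α hτ
  have hY : HasLaw (fun ω => (α : ℂ) * X ω + Z ω) (complexGaussian τ.toNNReal) μ :=
    measurePreserving_fst.comp_hasLaw hE
  have i1 : Integrable (fun ω => ‖Z ω‖ ^ 2 / σ) μ :=
    (hZ.integrable_comp (integrable_sq_norm_complexGaussian hσ.le)).div_const σ
  have i2 : Integrable (fun ω => N ω ^ 2 / (2 * ς)) μ :=
    (hN.integrable_comp (integrable_sq_gaussian _)).div_const _
  have i3 : Integrable (fun ω => ‖(α : ℂ) * X ω + Z ω‖ ^ 2 / τ) μ :=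
    (hY.integrable_comp (integrable_sq_norm_complexGaussian hτ0.le)).div_const τ
  have i4 : Integrable (fun ω => 1 / 2 *
      Real.log (powerVariance k (α / τ) (σ / τ) ς ((α : ℂ) * X ω + Z ω) / ς)) μ :=
    (hY.integrable_comp (integrable_log_powerVariance k hσ hς hτ0)).const_mul _
  have i5 : Integrable (fun ω => 1 / 2 * normalizedSquare k (α / τ) (σ / τ) ς
      ((α : ℂ) * X ω + Z ω,
        (X ω - ((α / τ : ℝ) : ℂ) * ((α : ℂ) * X ω + Z ω), N ω))) μ :=
    (hE.integrable_comp (integrable_normalizedSquare _ k (α / τ) hs hς)).const_mul _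
  have e1 : ∫ ω, ‖Z ω‖ ^ 2 / σ ∂μ = 1 := by
    rw [integral_div, show ∫ ω, ‖Z ω‖ ^ 2 ∂μ = σ from
      (hZ.integral_comp (f := fun z : ℂ => ‖z‖ ^ 2) (by fun_prop)).trans
        (integral_sq_norm_complexGaussian hσ.le), div_self hσ.ne']
  have e2 : ∫ ω, N ω ^ 2 / (2 * ς) ∂μ = 1 / 2 := by
    rw [integral_div, show ∫ ω, N ω ^ 2 ∂μ = ς from
      (hN.integral_comp (f := fun n : ℝ => n ^ 2) (by fun_prop)).trans
        (integral_sq_gaussian hς.le)]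
    field_simp
  have e3 : ∫ ω, ‖(α : ℂ) * X ω + Z ω‖ ^ 2 / τ ∂μ = 1 := by
    rw [integral_div, show ∫ ω, ‖(α : ℂ) * X ω + Z ω‖ ^ 2 ∂μ = τ from
      (hY.integral_comp (f := fun z : ℂ => ‖z‖ ^ 2) (by fun_prop)).trans
        (integral_sq_norm_complexGaussian hτ0.le), div_self hτ0.ne']
  have e4 : ∫ ω, 1 / 2 *
      Real.log (powerVariance k (α / τ) (σ / τ) ς ((α : ℂ) * X ω + Z ω) / ς) ∂μ =
      1 / 2 * ∫ y, Real.log (powerVariance k (α / τ) (σ / τ) ς y / ς)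
        ∂complexGaussian τ.toNNReal := by
    rw [integral_const_mul]
    congr 1
    exact hY.integral_comp
      (f := fun y => Real.log (powerVariance k (α / τ) (σ / τ) ς y / ς))
      (integrable_log_powerVariance k hσ hς hτ0).1
  have e5 : ∫ ω, 1 / 2 * normalizedSquare k (α / τ) (σ / τ) ς
      ((α : ℂ) * X ω + Z ω,
        (X ω - ((α / τ : ℝ) : ℂ) * ((α : ℂ) * X ω + Z ω), N ω)) ∂μ = 1 / 2 := by
    rw [integral_const_mul, show ∫ ω, normalizedSquare k (α / τ) (σ / τ) ς
      ((α : ℂ) * X ω + Z ω,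
        (X ω - ((α / τ : ℝ) : ℂ) * ((α : ℂ) * X ω + Z ω), N ω)) ∂μ = 1 from
      (hE.integral_comp (measurable_normalizedSquare _ _ _ _).aestronglyMeasurable).trans
        (integral_normalizedSquare _ k (α / τ) hs hς), mul_one]
  have hgT : ∀ ω, logDensityRatio α k (α / τ) (σ / τ) σ τ ς
      (X ω, ((α : ℂ) * X ω + Z ω, k * ‖X ω‖ ^ 2 + N ω)) =
      Real.log (τ / σ) - ‖Z ω‖ ^ 2 / σ - N ω ^ 2 / (2 * ς) + ‖(α : ℂ) * X ω + Z ω‖ ^ 2 / τ +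
        1 / 2 * Real.log (powerVariance k (α / τ) (σ / τ) ς ((α : ℂ) * X ω + Z ω) / ς) +
        1 / 2 * normalizedSquare k (α / τ) (σ / τ) ς ((α : ℂ) * X ω + Z ω,
          (X ω - ((α / τ : ℝ) : ℂ) * ((α : ℂ) * X ω + Z ω), N ω)) := fun ω => by
    simp only [logDensityRatio, normalizedSquare, add_sub_cancel_left,
      power_output_sub_powerMean]
    rw [mul_comm (2 : ℝ) (powerVariance _ _ _ _ _), ← div_div]
    ring
  have j1 := (integrable_const (μ := μ) (Real.log (τ / σ))).sub i1
  have j2 := j1.sub i2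
  have j3 := j2.add i3
  have j4 := j3.add i4
  have hgint : Integrable (fun ω => logDensityRatio α k (α / τ) (σ / τ) σ τ ς
      (X ω, ((α : ℂ) * X ω + Z ω, k * ‖X ω‖ ^ 2 + N ω))) μ := by
    simp_rw [hgT]
    exact j4.add i5
  have hgval : ∫ ω, logDensityRatio α k (α / τ) (σ / τ) σ τ ς
      (X ω, ((α : ℂ) * X ω + Z ω, k * ‖X ω‖ ^ 2 + N ω)) ∂μ =
      informationBound (α ^ 2 / σ) (k ^ 2 / ς) := by
    rw [← informationBound_eq hσ hς hτ]
    simp_rw [hgT]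
    refine (integral_add j4 i5).trans ?_
    rw [e5, integral_add' j3 i4, e4, integral_add' j2 i3, e3, integral_sub' j1 i2, e2,
      integral_sub' (integrable_const (Real.log (τ / σ))) i1, e1,
      integral_const, probReal_univ, one_smul]
    ring
  have := Measure.isProbabilityMeasure_map (μ := μ) hTm
  rw [hsnd, h.hasLaw_input.map_eq]
  have hmain := toReal_klDiv_prod_snd_le_integral (complexGaussian 1)
    ((volume : Measure ℂ).prod (volume : Measure ℝ))
    (w := fun p => ENNReal.ofReal (transitionDensity α k σ ς p)) (by fun_prop)
    (fun p => (ENNReal.ofReal_pos.2 (transitionDensity_pos α k hσ hς p)).ne')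
    (h.map_eq_withDensity hσ hς α k)
    (q := fun y => ENNReal.ofReal (testOutputDensity k (α / τ) (σ / τ) τ ς y))
    (measurable_testOutputDensity _ _ _ _ _).ennreal_ofReal
    (lintegral_testOutputDensity k (α / τ) hs.le hτ0 hς).le
    (g := logDensityRatio α k (α / τ) (σ / τ) σ τ ς)
    ((integrable_map_measure hgm.aestronglyMeasurable hTm).2 hgint)
    (fun p => by
      rw [← ENNReal.ofReal_mul (transitionDensity_pos α k hσ hς p).le,
        transitionDensity_mul_exp_neg α k _ hs.le hσ hτ0 hς])
  rw [integral_map hTm hgm.aestronglyMeasurable, hgval] at hmain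
  exact hmain

end UpperBound

/-! ### Phase error of the linear branch, pointwise -/

section PhaseError

/-- The phase difference, in `(-π, π]`, between `x` and `y`. -/
noncomputable def phaseError (x y : ℂ) : ℝ := (x * Complex.exp (-(y.arg * Complex.I))).arg

theorem measurable_phaseError : Measurable fun p : ℂ × ℂ => phaseError p.1 p.2 := by
  have : Measurable fun p : ℂ × ℂ => p.1 * Complex.exp (-(p.2.arg * Complex.I)) := by
    have := Complex.measurable_arg
    fun_prop
  exact Complex.measurable_arg.comp this

theorem norm_exp_neg_arg (y : ℂ) : ‖Complex.exp (-(y.arg * Complex.I))‖ = 1 := by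
  have := Complex.norm_exp_ofReal_mul_I (-y.arg)
  push_cast at this
  rwa [neg_mul] at this

theorem mul_exp_neg_arg (y : ℂ) : y * Complex.exp (-(y.arg * Complex.I)) = (‖y‖ : ℂ) := by
  conv_lhs => rw [← Complex.norm_mul_exp_arg_mul_I y]
  rw [mul_assoc]
  simp [← Complex.exp_add]

theorem noise_mul_exp_neg_arg (α : ℝ) (x z : ℂ) :
    z * Complex.exp (-(((α : ℂ) * x + z).arg * Complex.I)) =
      (‖(α : ℂ) * x + z‖ : ℂ) -
        α * (x * Complex.exp (-(((α : ℂ) * x + z).arg * Complex.I))) := by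
  rw [← mul_exp_neg_arg]
  ring

/-- The sine of the phase error, in terms of the noise. -/
theorem mul_norm_mul_sin_phaseError (α : ℝ) (x z : ℂ) :
    α * ‖x‖ * Real.sin (phaseError x ((α : ℂ) * x + z)) =
      -(z * Complex.exp (-(((α : ℂ) * x + z).arg * Complex.I))).im := by
  set u := Complex.exp (-(((α : ℂ) * x + z).arg * Complex.I)) with hu
  have h1 : ‖x * u‖ = ‖x‖ := by rw [norm_mul, hu, norm_exp_neg_arg, mul_one]
  have h2 : ‖x‖ * Real.sin (phaseError x ((α : ℂ) * x + z)) = (x * u).im := by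
    rw [← h1]; exact Complex.norm_mul_sin_arg _
  rw [noise_mul_exp_neg_arg, ← hu, mul_assoc, h2]
  simp

/-- Domination uniform in `α`. If the phase error is at most `π / 2`, Jordan's inequality bounds it
by its sine, which the noise controls. Otherwise the noise has overcome the signal, `α ‖x‖ ≤ ‖z‖`,
and the trivial bound `π` suffices. -/
theorem mul_norm_mul_abs_phaseError_le {α : ℝ} (hα : 0 ≤ α) (x z : ℂ) :
    α * ‖x‖ * |phaseError x ((α : ℂ) * x + z)| ≤ Real.pi * ‖z‖ := by
  have hsin := mul_norm_mul_sin_phaseError α x z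
  have hz := noise_mul_exp_neg_arg α x z
  set y := (α : ℂ) * x + z with hy
  set u := Complex.exp (-(y.arg * Complex.I)) with hu
  have hnu : ‖u‖ = 1 := norm_exp_neg_arg y
  have hnz : ‖z * u‖ = ‖z‖ := by rw [norm_mul, hnu, mul_one]
  have hnx : ‖x * u‖ = ‖x‖ := by rw [norm_mul, hnu, mul_one]
  have hd : phaseError x y = (x * u).arg := rfl
  have hx0 : 0 ≤ α * ‖x‖ := by positivity
  rcases le_or_gt (x * u).re 0 with hre | hre
  · have h1 : (α * ‖x‖) ^ 2 ≤ ‖z‖ ^ 2 := by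
      rw [← hnz, hz, ← hnx, mul_pow, Complex.sq_norm, Complex.sq_norm, Complex.normSq_apply,
        Complex.normSq_apply]
      simp only [Complex.sub_re, Complex.ofReal_re, Complex.re_ofReal_mul, Complex.sub_im,
        Complex.ofReal_im, Complex.im_ofReal_mul]
      nlinarith [mul_nonneg (mul_nonneg (norm_nonneg y) hα) (neg_nonneg.2 hre),
        sq_nonneg ‖y‖]
    have h2 : α * ‖x‖ ≤ ‖z‖ := le_of_sq_le_sq h1 (norm_nonneg z)
    rw [hd]
    calc α * ‖x‖ * |(x * u).arg| ≤ α * ‖x‖ * Real.pi :=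
          mul_le_mul_of_nonneg_left (Complex.abs_arg_le_pi _) hx0
      _ ≤ ‖z‖ * Real.pi := mul_le_mul_of_nonneg_right h2 Real.pi_pos.le
      _ = Real.pi * ‖z‖ := mul_comm _ _
  · have h1 : |phaseError x y| ≤ Real.pi / 2 :=
      Complex.abs_arg_le_pi_div_two_iff.2 hre.le
    have h2 := Real.mul_abs_le_abs_sin h1
    have h3 : α * ‖x‖ * |Real.sin (phaseError x y)| ≤ ‖z‖ := by
      rw [← abs_of_nonneg hx0, ← abs_mul, hsin, abs_neg, ← hnz]
      exact Complex.abs_im_le_norm _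
    have h4 : α * ‖x‖ * (2 / Real.pi * |phaseError x y|) ≤ ‖z‖ :=
      (mul_le_mul_of_nonneg_left h2 hx0).trans h3
    have h5 : α * ‖x‖ * |phaseError x y| =
        Real.pi / 2 * (α * ‖x‖ * (2 / Real.pi * |phaseError x y|)) := by
      field_simp
    rw [h5]
    have := Real.pi_pos
    nlinarith [norm_nonneg z]

/-- The argument is invariant under positive scaling, so `α x + z` may be replaced by `x + z / α`,
which tends to `x`. The form `conj w / ‖w‖` is continuous away from `0`, so the branch cut of `arg`
plays no role. -/
theorem tendsto_exp_neg_arg {x : ℂ} (hx : x ≠ 0) (z : ℂ) :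
    Tendsto (fun α : ℝ => Complex.exp (-(((α : ℂ) * x + z).arg * Complex.I))) atTop
      (𝓝 ((starRingEnd ℂ) x / ‖x‖)) := by
  have h1 : Tendsto (fun α : ℝ => x + ((α⁻¹ : ℝ) : ℂ) * z) atTop (𝓝 x) := by
    have h := (Complex.continuous_ofReal.tendsto 0).comp tendsto_inv_atTop_zero
    simpa using (h.mul_const z).const_add x
  have h2 : Tendsto (fun α : ℝ => (starRingEnd ℂ) (x + ((α⁻¹ : ℝ) : ℂ) * z) /
      (‖x + ((α⁻¹ : ℝ) : ℂ) * z‖ : ℂ)) atTop (𝓝 ((starRingEnd ℂ) x / ‖x‖)) := by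
    refine ((Complex.continuous_conj.tendsto x).comp h1).div
      ((Complex.continuous_ofReal.tendsto _).comp h1.norm) ?_
    simpa using hx
  refine h2.congr' ?_
  filter_upwards [eventually_gt_atTop 0, h1.eventually_ne hx] with α hα hne
  set w := x + ((α⁻¹ : ℝ) : ℂ) * z with hw
  have h3 : (α : ℂ) * x + z = (α : ℂ) * w := by
    have : (α : ℂ) ≠ 0 := by exact_mod_cast hα.ne'
    rw [hw]; push_cast; field_simp
  rw [h3, Complex.arg_real_mul _ hα]
  have h4 := mul_exp_neg_arg w
  have h5 : (‖w‖ : ℂ) ≠ 0 := by simpa using hne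
  have h6 : (starRingEnd ℂ) w * w = (‖w‖ : ℂ) * ‖w‖ := by
    rw [mul_comm, Complex.mul_conj, Complex.normSq_eq_norm_sq]; push_cast; ring
  rw [div_eq_iff h5]
  apply mul_left_cancel₀ hne
  rw [mul_comm w, h6, ← mul_assoc, h4]

/-- The sine of the phase error, scaled by `α ‖x‖`, is exactly a component of the rotated noise up
to sign. Dividing by `sinc`, which tends to `1`, replaces the sine by the angle. -/
theorem tendsto_sq_phaseError {x : ℂ} (hx : x ≠ 0) (z : ℂ) :
    Tendsto (fun α : ℝ => (α * ‖x‖ * phaseError x ((α : ℂ) * x + z)) ^ 2) atTop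
      (𝓝 ((z * ((starRingEnd ℂ) x / ‖x‖)).im ^ 2)) := by
  have hx0 : 0 < ‖x‖ := norm_pos_iff.2 hx
  have h0 : Tendsto (fun α : ℝ => phaseError x ((α : ℂ) * x + z)) atTop (𝓝 0) := by
    have h1 : Tendsto (fun α : ℝ => Real.pi * ‖z‖ / ‖x‖ * α⁻¹) atTop (𝓝 0) := by
      simpa using tendsto_inv_atTop_zero.const_mul (Real.pi * ‖z‖ / ‖x‖)
    refine squeeze_zero_norm' ?_ h1
    filter_upwards [eventually_gt_atTop 0] with α hα
    have h2 := mul_norm_mul_abs_phaseError_le hα.le x z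
    rw [Real.norm_eq_abs, ← div_eq_mul_inv, div_div, le_div_iff₀ (by positivity)]
    linarith
  have h1 : Tendsto (fun α : ℝ => Real.sinc (phaseError x ((α : ℂ) * x + z))) atTop (𝓝 1) := by
    have := (Real.continuous_sinc.tendsto 0).comp h0
    rwa [Real.sinc_zero] at this
  have h2 := ((Complex.continuous_im.tendsto _).comp
    ((tendsto_exp_neg_arg hx z).const_mul z)).neg
  have h3 := (h2.div h1 one_ne_zero).pow 2
  simp only [div_one, neg_sq] at h3
  refine h3.congr' ?_
  filter_upwards [h1.eventually_ne one_ne_zero] with α hne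
  simp only [Function.comp, Pi.div_apply]
  rw [← mul_norm_mul_sin_phaseError α x z, div_pow, div_eq_iff (pow_ne_zero 2 hne), ← mul_pow]
  congr 1
  by_cases hd : phaseError x ((α : ℂ) * x + z) = 0
  · simp [hd]
  · rw [Real.sinc_of_ne_zero hd]
    field_simp

end PhaseError

/-! ### Mean square phase error at high power -/

section PhaseLoss

variable {Ω : Type*} [MeasurableSpace Ω] {μ : Measure Ω}
  {X Z : Ω → ℂ} {N : Ω → ℝ} {σ ς : ℝ}

theorem IsGaussianChannel.integrable_sq_phaseError (h : IsGaussianChannel μ X Z N σ ς)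
    (hσ : 0 < σ) {α : ℝ} (hα : 0 ≤ α) :
    Integrable (fun ω => (α * ‖X ω‖ * phaseError (X ω) ((α : ℂ) * X ω + Z ω)) ^ 2) μ := by
  have hXm : AEMeasurable X μ := h.hasLaw_input.aemeasurable
  have hZm : AEMeasurable Z μ := h.hasLaw_linear_noise.aemeasurable
  have hdm : AEMeasurable (fun ω => phaseError (X ω) ((α : ℂ) * X ω + Z ω)) μ :=
    measurable_phaseError.comp_aemeasurable (hXm.prodMk (by fun_prop))
  refine ((h.hasLaw_linear_noise.integrable_comp
    (integrable_sq_norm_complexGaussian hσ.le)).const_mul (Real.pi ^ 2)).mono'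
    (AEMeasurable.aestronglyMeasurable (by fun_prop)) (ae_of_all _ fun ω => ?_)
  rw [Real.norm_of_nonneg (sq_nonneg _), ← mul_pow, ← sq_abs, abs_mul,
    abs_of_nonneg (show 0 ≤ α * ‖X ω‖ by positivity)]
  exact pow_le_pow_left₀ (by positivity) (mul_norm_mul_abs_phaseError_le hα _ _) 2

theorem integral_sq_im_mul_complexGaussian (hσ : 0 < σ) (m : ℂ) :
    ∫ z : ℂ, (z * m).im ^ 2 ∂complexGaussian σ.toNNReal = σ * ‖m‖ ^ 2 / 2 := by
  rw [integral_complexGaussian_toNNReal hσ.le _ (by fun_prop)]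
  have h : ∀ z : ℂ, (((√σ : ℝ) : ℂ) * z * m).im ^ 2 = σ * (z * m).im ^ 2 := fun z => by
    rw [mul_assoc, Complex.im_ofReal_mul, mul_pow, Real.sq_sqrt hσ.le]
  simp_rw [h]
  rw [integral_const_mul, integral_sq_im_mul]
  ring

theorem complexGaussian_one_absolutelyContinuous : complexGaussian 1 ≪ volume := by
  rw [complexGaussian_one_eq_toNNReal, complexGaussian_toNNReal_eq_withDensity one_pos]
  exact withDensity_absolutelyContinuous _ _

/-- Dominated convergence with majorant `π² ‖Z‖²`. In the limit only the noise component orthogonal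
to the input remains, and it carries half the noise variance. -/
theorem IsGaussianChannel.tendsto_integral_sq_phaseError (h : IsGaussianChannel μ X Z N σ ς)
    (hσ : 0 < σ) :
    Tendsto (fun α : ℝ => ∫ ω, (α * ‖X ω‖ * phaseError (X ω) ((α : ℂ) * X ω + Z ω)) ^ 2 ∂μ)
      atTop (𝓝 (σ / 2)) := by
  have hXm : AEMeasurable X μ := h.hasLaw_input.aemeasurable
  have hXne : ∀ᵐ x ∂complexGaussian 1, x ≠ 0 :=
    complexGaussian_one_absolutelyContinuous.ae_le (compl_mem_ae_iff.2 (measure_singleton 0))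
  have hXne' : ∀ᵐ ω ∂μ, X ω ≠ 0 := by
    have := hXne
    rw [← h.hasLaw_input.map_eq] at this
    exact ae_of_ae_map hXm this
  have hconj : Measurable (starRingEnd ℂ) := Complex.continuous_conj.measurable
  have hfm : Measurable fun p : ℂ × ℂ => (p.2 * ((starRingEnd ℂ) p.1 / ‖p.1‖)).im ^ 2 := by
    fun_prop
  have hbound : ∀ p : ℂ × ℂ, (p.2 * ((starRingEnd ℂ) p.1 / ‖p.1‖)).im ^ 2 ≤ ‖p.2‖ ^ 2 :=
    fun p => by
      refine (sq_im_mul_le _ _).trans ?_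
      refine mul_le_of_le_one_left (sq_nonneg _) ?_
      rw [norm_div, RCLike.norm_conj, Complex.norm_real, norm_norm]
      exact pow_le_one₀ (by positivity) (div_self_le_one _)
  have hint : Integrable (fun p : ℂ × ℂ => (p.2 * ((starRingEnd ℂ) p.1 / ‖p.1‖)).im ^ 2)
      ((complexGaussian 1).prod (complexGaussian σ.toNNReal)) := by
    refine ((integrable_sq_norm_complexGaussian hσ.le).comp_snd (complexGaussian 1)).mono'
      hfm.aestronglyMeasurable (ae_of_all _ fun p => ?_)
    rw [Real.norm_of_nonneg (sq_nonneg _)]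
    exact hbound p
  have hlim : ∫ ω, (Z ω * ((starRingEnd ℂ) (X ω) / ‖X ω‖)).im ^ 2 ∂μ = σ / 2 := by
    have h1 := h.hasLaw_input_linear_noise.integral_comp
      (f := fun p : ℂ × ℂ => (p.2 * ((starRingEnd ℂ) p.1 / ‖p.1‖)).im ^ 2)
      hfm.aestronglyMeasurable
    refine h1.trans ?_
    rw [integral_prod _ hint]
    have h2 : ∀ᵐ x ∂complexGaussian 1, ∫ z : ℂ, (z * ((starRingEnd ℂ) x / ‖x‖)).im ^ 2
        ∂complexGaussian σ.toNNReal = σ / 2 := by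
      filter_upwards [hXne] with x hx
      rw [integral_sq_im_mul_complexGaussian hσ, norm_div, RCLike.norm_conj, Complex.norm_real,
        norm_norm, div_self (norm_ne_zero_iff.2 hx)]
      ring
    rw [integral_congr_ae h2]
    simp
  rw [← hlim]
  refine tendsto_integral_filter_of_dominated_convergence
    (fun ω => Real.pi ^ 2 * ‖Z ω‖ ^ 2) ?_ ?_
    ((h.hasLaw_linear_noise.integrable_comp
      (integrable_sq_norm_complexGaussian hσ.le)).const_mul (Real.pi ^ 2)) ?_
  · filter_upwards [eventually_ge_atTop 0] with α hα
    exact (h.integrable_sq_phaseError hσ hα).1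
  · filter_upwards [eventually_ge_atTop 0] with α hα
    refine ae_of_all _ fun ω => ?_
    rw [Real.norm_of_nonneg (sq_nonneg _), ← mul_pow, ← sq_abs, abs_mul,
      abs_of_nonneg (show 0 ≤ α * ‖X ω‖ by positivity)]
    exact pow_le_pow_left₀ (by positivity) (mul_norm_mul_abs_phaseError_le hα _ _) 2
  · filter_upwards [hXne'] with ω hω
    exact tendsto_sq_phaseError hω (Z ω)

end PhaseLoss

/-! ### Lower bound from a guessed law of the input given the output -/

section LowerBound

open InformationTheory

variable {Ω : Type*} [MeasurableSpace Ω] {μ : Measure Ω}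
  {X Z : Ω → ℂ} {N : Ω → ℝ} {σ ς : ℝ}

/-- The logarithm of the ratio of a conditional density of the input given the output to the
density of the input, where `r` is the modulus of the input, `d` the phase difference between the
input and the linear output, and `b` the power output. -/
noncomputable def reverseLogRatio (α k σ ς r d b : ℝ) : ℝ :=
  Real.log Real.pi + r ^ 2 + Real.log 2 +
    (Real.log k - 1 / 2 * Real.log (2 * Real.pi * ς) - (b - k * r ^ 2) ^ 2 / (2 * ς)) +
    (1 / 2 * (Real.log (2 * α ^ 2 / σ) + Real.log (r ^ 2)) - 1 / 2 * Real.log (2 * Real.pi) -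
      (α * r * d) ^ 2 / σ)

/-- The right side is the guessed input density: `k r²` Gaussian about `b`, the phase error Gaussian
with variance `σ / (2 α² r²)`. The factor `2 * k` is the Jacobian `2 k r` of `r ↦ k r²` without the
`r` supplied by polar coordinates. -/
theorem mul_exp_reverseLogRatio {α k r : ℝ} (hα : 0 < α) (hk : 0 < k) (hσ : 0 < σ) (hς : 0 < ς)
    (hr : 0 < r) (d b : ℝ) :
    (Real.pi * 1)⁻¹ * Real.exp (-r ^ 2 / 1) * Real.exp (reverseLogRatio α k σ ς r d b) =
      2 * k * gaussianPDFReal 0 ς.toNNReal (k * r ^ 2 - b) *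
        gaussianPDFReal 0 (σ / (2 * α ^ 2 * r ^ 2)).toNNReal d := by
  have hv : 0 < σ / (2 * α ^ 2 * r ^ 2) := by positivity
  unfold gaussianPDFReal
  rw [Real.coe_toNNReal _ hς.le, Real.coe_toNNReal _ hv.le]
  have e1 : (√(2 * Real.pi * ς))⁻¹ = Real.exp (-(1 / 2 * Real.log (2 * Real.pi * ς))) := by
    rw [Real.exp_neg, show 1 / 2 * Real.log (2 * Real.pi * ς) = Real.log √(2 * Real.pi * ς) by
      rw [Real.log_sqrt (by positivity)]; ring, Real.exp_log (by positivity)]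
  have e2 : (√(2 * Real.pi * (σ / (2 * α ^ 2 * r ^ 2))))⁻¹ =
      Real.exp (1 / 2 * (Real.log (2 * α ^ 2 / σ) + Real.log (r ^ 2)) -
        1 / 2 * Real.log (2 * Real.pi)) := by
    rw [show 1 / 2 * (Real.log (2 * α ^ 2 / σ) + Real.log (r ^ 2)) -
        1 / 2 * Real.log (2 * Real.pi) =
        -Real.log √(2 * Real.pi * (σ / (2 * α ^ 2 * r ^ 2))) by
      rw [Real.log_sqrt (by positivity), ← Real.log_mul (by positivity) (by positivity),
        ← mul_sub, ← Real.log_div (by positivity) (by positivity), neg_div',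
        ← Real.log_inv, mul_comm, mul_one_div]
      congr 2
      field_simp, Real.exp_neg, Real.exp_log (by positivity)]
  have e3 : (Real.pi * 1)⁻¹ = Real.exp (-Real.log Real.pi) := by
    rw [Real.exp_neg, Real.exp_log Real.pi_pos, mul_one]
  have e4 : 2 * k = Real.exp (Real.log 2 + Real.log k) := by
    rw [Real.exp_add, Real.exp_log two_pos, Real.exp_log hk]
  rw [e1, e2, e3, e4]
  simp only [← Real.exp_add]
  congr 1
  unfold reverseLogRatio
  have e5 : -(d - 0) ^ 2 / (2 * (σ / (2 * α ^ 2 * r ^ 2))) = -((α * r * d) ^ 2 / σ) := by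
    field_simp
    ring
  rw [e5]
  ring

theorem measurable_reverseLogRatio (α k σ ς : ℝ) : Measurable fun p : ℂ × ℂ × ℝ =>
    reverseLogRatio α k σ ς ‖p.1‖ (phaseError p.1 p.2.1) p.2.2 := by
  have h1 : Measurable fun p : ℂ × ℂ × ℝ => phaseError p.1 p.2.1 :=
    measurable_phaseError.comp (g := fun q : ℂ × ℂ => phaseError q.1 q.2)
      (f := fun p : ℂ × ℂ × ℝ => (p.1, p.2.1)) (by fun_prop)
  unfold reverseLogRatio
  fun_prop

theorem ofReal_mul_exp_reverseLogRatio_polarCoord {α k : ℝ} (hα : 0 < α) (hk : 0 < k) (hσ : 0 < σ)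
    (hς : 0 < ς) (b : ℝ) {p : ℝ × ℝ} (hp : p ∈ Set.Ioi (0 : ℝ) ×ˢ Set.Ioo (-Real.pi) Real.pi) :
    ENNReal.ofReal p.1 • (ENNReal.ofReal (complexGaussianPDFReal 1 (Complex.polarCoord.symm p)) *
        ENNReal.ofReal (Real.exp (reverseLogRatio α k σ ς ‖Complex.polarCoord.symm p‖
          (Complex.polarCoord.symm p).arg b))) =
      ENNReal.ofReal (2 * k * p.1) *
          ENNReal.ofReal (gaussianPDFReal 0 ς.toNNReal (k * p.1 ^ 2 - b)) *
        gaussianPDF 0 (σ / (2 * α ^ 2 * p.1 ^ 2)).toNNReal p.2 := by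
  have hr : 0 < p.1 := hp.1
  have harg : (Complex.polarCoord.symm p).arg = p.2 := by
    rw [Complex.polarCoord_symm_apply]
    push_cast
    exact Complex.arg_mul_cos_add_sin_mul_I hr ⟨hp.2.1, hp.2.2.le⟩
  have hnorm : ‖Complex.polarCoord.symm p‖ = p.1 := by
    rw [Complex.norm_polarCoord_symm, abs_of_pos hr]
  have hg0 := gaussianPDFReal_nonneg 0 ς.toNNReal (k * p.1 ^ 2 - b)
  rw [harg, hnorm, complexGaussianPDFReal, hnorm, smul_eq_mul, gaussianPDF,
    ← ENNReal.ofReal_mul (by positivity), mul_exp_reverseLogRatio hα hk hσ hς hr,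
    ← ENNReal.ofReal_mul hr.le, ← ENNReal.ofReal_mul (by positivity),
    ← ENNReal.ofReal_mul (by positivity)]
  congr 1
  ring

/-- Both Gaussians are truncated, to `k r² > 0` and to angles in `(-π, π)`, so the mass is at most
`1`. A subprobability density is enough for the variational bound. -/
theorem lintegral_reverse_density_le {α k : ℝ} (hα : 0 < α) (hk : 0 < k) (hσ : 0 < σ)
    (hς : 0 < ς) (b : ℝ) :
    ∫⁻ p in Set.Ioi (0 : ℝ) ×ˢ Set.Ioo (-Real.pi) Real.pi,
      ENNReal.ofReal (2 * k * p.1) *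
          ENNReal.ofReal (gaussianPDFReal 0 ς.toNNReal (k * p.1 ^ 2 - b)) *
        gaussianPDF 0 (σ / (2 * α ^ 2 * p.1 ^ 2)).toNNReal p.2 ≤ 1 := by
  have hgm := measurable_gaussianPDFReal 0 ς.toNNReal
  rw [Measure.volume_eq_prod, ← Measure.prod_restrict]
  refine (lintegral_prod_le _).trans ?_
  calc ∫⁻ r in Set.Ioi (0 : ℝ), ∫⁻ θ in Set.Ioo (-Real.pi) Real.pi,
          ENNReal.ofReal (2 * k * r) *
            ENNReal.ofReal (gaussianPDFReal 0 ς.toNNReal (k * r ^ 2 - b)) *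
          gaussianPDF 0 (σ / (2 * α ^ 2 * r ^ 2)).toNNReal θ
      ≤ ∫⁻ r in Set.Ioi (0 : ℝ), ENNReal.ofReal (2 * k * r) *
            ENNReal.ofReal (gaussianPDFReal 0 ς.toNNReal (k * r ^ 2 - b)) := by
        refine setLIntegral_mono' measurableSet_Ioi fun r hr => ?_
        have hr : 0 < r := hr
        have hv : 0 < σ / (2 * α ^ 2 * r ^ 2) := by positivity
        rw [lintegral_const_mul _ (measurable_gaussianPDF _ _)]
        refine mul_le_of_le_one_right' ?_
        exact (setLIntegral_le_lintegral _ _).trans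
          (lintegral_gaussianPDF_eq_one 0 (Real.toNNReal_pos.2 hv).ne').le
    _ = ∫⁻ t in Set.Ioi (0 : ℝ), ENNReal.ofReal (gaussianPDFReal 0 ς.toNNReal (t - b)) :=
        lintegral_Ioi_comp_sq hk fun t =>
          ENNReal.ofReal (gaussianPDFReal 0 ς.toNNReal (t - b))
    _ ≤ ∫⁻ t, ENNReal.ofReal (gaussianPDFReal 0 ς.toNNReal (t - b)) :=
        setLIntegral_le_lintegral _ _
    _ = 1 := by
        rw [lintegral_sub_right_eq_self
          (fun t => ENNReal.ofReal (gaussianPDFReal 0 ς.toNNReal t)) b]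
        exact lintegral_gaussianPDFReal_eq_one 0 (Real.toNNReal_pos.2 hς).ne'

theorem lintegral_exp_reverseLogRatio_le {α k : ℝ} (hα : 0 < α) (hk : 0 < k) (hσ : 0 < σ)
    (hς : 0 < ς) (y : ℂ) (b : ℝ) :
    ∫⁻ x, ENNReal.ofReal (Real.exp (reverseLogRatio α k σ ς ‖x‖ (phaseError x y) b))
      ∂complexGaussian 1 ≤ 1 := by
  have hm : Measurable fun x : ℂ => reverseLogRatio α k σ ς ‖x‖ (phaseError x y) b := by
    have h := (measurable_reverseLogRatio α k σ ς).comp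
      (measurable_prodMk_right (α := ℂ) (y := (y, b)))
    simpa only [Function.comp_def] using h
  set u := Complex.exp (y.arg * Complex.I) with hu
  have hnu : ‖u‖ = 1 := Complex.norm_exp_ofReal_mul_I _
  have hphase : ∀ x : ℂ, phaseError (u * x) y = x.arg := fun x => by
    unfold phaseError
    rw [hu, mul_comm, ← mul_assoc, ← Complex.exp_add]
    simp
  -- Rotating the input by the phase of `y` turns the phase error into `x.arg`, ready for polar
  -- coordinates.
  rw [← map_mul_complexGaussian_of_norm_eq_one hnu, lintegral_map (by fun_prop) (by fun_prop)]
  simp_rw [hphase, norm_mul, hnu, one_mul]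
  have hm' : Measurable fun x : ℂ => reverseLogRatio α k σ ς ‖x‖ x.arg b := by
    have := Complex.measurable_arg
    unfold reverseLogRatio
    fun_prop
  rw [complexGaussian_one_eq_toNNReal, lintegral_complexGaussian one_pos (by fun_prop),
    ← Complex.lintegral_comp_polarCoord_symm, polarCoord_target]
  have hcongr := setLIntegral_congr_fun (μ := (volume : Measure (ℝ × ℝ)))
    (measurableSet_Ioi.prod measurableSet_Ioo) fun p hp =>
      ofReal_mul_exp_reverseLogRatio_polarCoord hα hk hσ hς b hp
  exact hcongr.trans_le (lintegral_reverse_density_le hα hk hσ hς b)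

/-- The mean of `reverseLogRatio`: the logarithms of `2` and `π` from the normalizations cancel,
`‖X‖ ^ 2` contributes `1` and the power noise `-1/2`, and the Jacobian term `½ log ‖X‖²` contributes
`-γ / 2`. The final bracket is the defect of the phase guess. -/
theorem IsGaussianChannel.le_toReal_klDiv (h : IsGaussianChannel μ X Z N σ ς) (hσ : 0 < σ)
    (hς : 0 < ς) {α k : ℝ} (hα : 0 < α) (hk : 0 < k) :
    1 / 2 * Real.log (2 * (α ^ 2 / σ) * (k ^ 2 / ς)) - Real.eulerMascheroniConstant / 2 +
        (1 / 2 - (∫ ω, (α * ‖X ω‖ * phaseError (X ω) ((α : ℂ) * X ω + Z ω)) ^ 2 ∂μ) / σ) ≤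
      (klDiv (μ.map fun ω => (X ω, ((α : ℂ) * X ω + Z ω, k * ‖X ω‖ ^ 2 + N ω)))
        ((μ.map X).prod
          (μ.map fun ω => ((α : ℂ) * X ω + Z ω, k * ‖X ω‖ ^ 2 + N ω)))).toReal := by
  have := h.isProbabilityMeasure
  have hX := h.hasLaw_input
  have hN := h.hasLaw_power_noise
  have hXm : AEMeasurable X μ := h.hasLaw_input.aemeasurable
  have hZm : AEMeasurable Z μ := h.hasLaw_linear_noise.aemeasurable
  have hNm : AEMeasurable N μ := h.hasLaw_power_noise.aemeasurable
  have hVm : AEMeasurable (fun ω => ((α : ℂ) * X ω + Z ω, k * ‖X ω‖ ^ 2 + N ω)) μ := by fun_prop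
  have hTm : AEMeasurable
      (fun ω => (X ω, ((α : ℂ) * X ω + Z ω, k * ‖X ω‖ ^ 2 + N ω))) μ := hXm.prodMk hVm
  have hgm := measurable_reverseLogRatio α k σ ς
  have i1 : Integrable (fun ω => ‖X ω‖ ^ 2) μ := hX.integrable_comp integrable_sq_norm
  have i2 : Integrable (fun ω => N ω ^ 2 / (2 * ς)) μ :=
    (hN.integrable_comp (integrable_sq_gaussian _)).div_const _
  have i3 : Integrable (fun ω => 1 / 2 * Real.log (‖X ω‖ ^ 2)) μ :=
    (hX.integrable_comp integrable_log_sq_norm).const_mul _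
  have i4 := (h.integrable_sq_phaseError hσ hα.le).div_const σ
  have e1 : ∫ ω, ‖X ω‖ ^ 2 ∂μ = 1 :=
    (hX.integral_comp (f := fun z : ℂ => ‖z‖ ^ 2) (by fun_prop)).trans integral_sq_norm
  have e2 : ∫ ω, N ω ^ 2 / (2 * ς) ∂μ = 1 / 2 := by
    rw [integral_div, show ∫ ω, N ω ^ 2 ∂μ = ς from
      (hN.integral_comp (f := fun n : ℝ => n ^ 2) (by fun_prop)).trans
        (integral_sq_gaussian hς.le)]
    field_simp
  have e3 : ∫ ω, 1 / 2 * Real.log (‖X ω‖ ^ 2) ∂μ = -Real.eulerMascheroniConstant / 2 := by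
    rw [integral_const_mul, show ∫ ω, Real.log (‖X ω‖ ^ 2) ∂μ = -Real.eulerMascheroniConstant from
      (hX.integral_comp (f := fun z : ℂ => Real.log (‖z‖ ^ 2)) integrable_log_sq_norm.1).trans
        integral_log_sq_norm]
    ring
  set K := Real.log Real.pi + Real.log 2 + Real.log k - 1 / 2 * Real.log (2 * Real.pi * ς) +
    1 / 2 * Real.log (2 * α ^ 2 / σ) - 1 / 2 * Real.log (2 * Real.pi) with hK
  have hgT : ∀ ω, reverseLogRatio α k σ ς ‖X ω‖ (phaseError (X ω) ((α : ℂ) * X ω + Z ω))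
      (k * ‖X ω‖ ^ 2 + N ω) = K + ‖X ω‖ ^ 2 - N ω ^ 2 / (2 * ς) +
        1 / 2 * Real.log (‖X ω‖ ^ 2) -
        (α * ‖X ω‖ * phaseError (X ω) ((α : ℂ) * X ω + Z ω)) ^ 2 / σ := fun ω => by
    unfold reverseLogRatio
    rw [add_sub_cancel_left, hK]
    ring
  have j1 := (integrable_const (μ := μ) K).add i1
  have j2 := j1.sub i2
  have j3 := j2.add i3
  have hgint : Integrable (fun ω => reverseLogRatio α k σ ς ‖X ω‖
      (phaseError (X ω) ((α : ℂ) * X ω + Z ω)) (k * ‖X ω‖ ^ 2 + N ω)) μ := by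
    simp_rw [hgT]
    exact j3.sub i4
  have hlog : Real.log (2 * (α ^ 2 / σ) * (k ^ 2 / ς)) =
      Real.log (2 * α ^ 2 / σ) + 2 * Real.log k - Real.log ς := by
    rw [Real.log_mul (by positivity) (by positivity), mul_div_assoc,
      Real.log_div (x := k ^ 2) (by positivity) (by positivity), Real.log_pow]
    push_cast
    ring
  have hgval : ∫ ω, reverseLogRatio α k σ ς ‖X ω‖
      (phaseError (X ω) ((α : ℂ) * X ω + Z ω)) (k * ‖X ω‖ ^ 2 + N ω) ∂μ =
      1 / 2 * Real.log (2 * (α ^ 2 / σ) * (k ^ 2 / ς)) - Real.eulerMascheroniConstant / 2 +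
        (1 / 2 -
          (∫ ω, (α * ‖X ω‖ * phaseError (X ω) ((α : ℂ) * X ω + Z ω)) ^ 2 ∂μ) / σ) := by
    simp_rw [hgT]
    refine (integral_sub j3 i4).trans ?_
    rw [integral_add' j2 i3, e3, integral_sub' j1 i2, e2,
      integral_add' (integrable_const K) i1, e1, integral_const, probReal_univ, one_smul,
      integral_div, hK, hlog,
      Real.log_mul (x := 2 * Real.pi) (by positivity) (by positivity),
      Real.log_mul (x := 2) (y := Real.pi) (by positivity) (by positivity)]
    ring
  have := Measure.isProbabilityMeasure_map (μ := μ) hTm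
  have := Measure.isProbabilityMeasure_map (μ := μ) hVm
  have := Measure.isProbabilityMeasure_map (μ := μ) hXm
  have hmain := integral_le_toReal_klDiv (h.toReal_klDiv_le hσ hς α k).1 hgm
    ((integrable_map_measure hgm.aestronglyMeasurable hTm).2 hgint)
    (by
      rw [hX.map_eq, lintegral_prod_symm _ hgm.exp.ennreal_ofReal.aemeasurable]
      calc _ ≤ ∫⁻ _, 1 ∂(μ.map fun ω => ((α : ℂ) * X ω + Z ω, k * ‖X ω‖ ^ 2 + N ω)) :=
            lintegral_mono fun y => lintegral_exp_reverseLogRatio_le hα hk hσ hς y.1 y.2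
        _ = 1 := by simp)
  rwa [integral_map hTm hgm.aestronglyMeasurable, hgval] at hmain

end LowerBound

/-! ### Upper bound at high power -/

section Asymptotics

open InformationTheory

/-- Serves for finiteness of the supremum at each fixed power: both ratios are largest when no
splitting factor is applied. -/
theorem informationBound_mono {a b a' b' : ℝ} (ha : 0 ≤ a) (hb : 0 ≤ b) (haa : a ≤ a')
    (hbb : b ≤ b') : informationBound a b ≤ informationBound a' b' := by
  have hform : ∀ a b : ℝ, (fun w : ℂ => Real.log ((1 + a) ^ 2 + b * (1 + 2 * a * ‖w‖ ^ 2))) =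
      fun w : ℂ => Real.log (((1 + a) ^ 2 + b) + b * (2 * a) * ‖w‖ ^ 2) := fun a b => by
    ext w; congr 1; ring
  have ha' := ha.trans haa
  have hb' := hb.trans hbb
  unfold informationBound
  refine mul_le_mul_of_nonneg_left (integral_mono ?_ ?_ fun w => ?_) (by norm_num)
  · rw [hform]
    exact integrable_log_affine_sq_norm (by positivity) (by positivity)
  · rw [hform]
    exact integrable_log_affine_sq_norm (by positivity) (by positivity)
  · refine Real.log_le_log (by positivity) ?_
    gcongr

/-- The limit, as the offset vanishes, of the mean of the logarithm of a shifted exponential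
variable. -/
theorem tendsto_integral_log_add_mul_sq_norm {C D : ℝ} (hC : 0 < C) (hD : 0 < D) :
    Tendsto (fun P : ℝ => ∫ w : ℂ, Real.log (C / P + D * ‖w‖ ^ 2) ∂complexGaussian 1) atTop
      (𝓝 (Real.log D - Real.eulerMascheroniConstant)) := by
  have hne : ∀ᵐ w ∂complexGaussian 1, w ≠ 0 :=
    complexGaussian_one_absolutelyContinuous.ae_le (compl_mem_ae_iff.2 (measure_singleton 0))
  have hval : ∫ w : ℂ, Real.log (D * ‖w‖ ^ 2) ∂complexGaussian 1 =
      Real.log D - Real.eulerMascheroniConstant := by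
    have h1 : ∀ᵐ w : ℂ ∂complexGaussian 1,
        Real.log (D * ‖w‖ ^ 2) = Real.log D + Real.log (‖w‖ ^ 2) := by
      filter_upwards [hne] with w hw
      exact Real.log_mul hD.ne' (by simpa using hw)
    rw [integral_congr_ae h1, integral_add (integrable_const _) integrable_log_sq_norm,
      integral_log_sq_norm]
    simp
    ring
  have hint : Integrable (fun w : ℂ => Real.log (D * ‖w‖ ^ 2)) (complexGaussian 1) := by
    refine ((integrable_const (Real.log D)).add integrable_log_sq_norm).congr ?_
    filter_upwards [hne] with w hw
    exact (Real.log_mul hD.ne' (by simpa using hw)).symm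
  rw [← hval]
  refine tendsto_integral_filter_of_dominated_convergence
    -- For `P ≥ 1` the integrand lies between its values at `P = ∞` and `P = 1`.
    (fun w => |Real.log (D * ‖w‖ ^ 2)| + |Real.log (C + D * ‖w‖ ^ 2)|) ?_ ?_
    (hint.abs.add (integrable_log_affine_sq_norm hC hD.le).abs) ?_
  · exact Eventually.of_forall fun P => Measurable.aestronglyMeasurable (by fun_prop)
  · filter_upwards [eventually_ge_atTop 1] with P hP
    filter_upwards [hne] with w hw
    have hw0 : 0 < ‖w‖ := norm_pos_iff.2 hw
    have hP0 : 0 < P := one_pos.trans_le hP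
    have h1 : Real.log (D * ‖w‖ ^ 2) ≤ Real.log (C / P + D * ‖w‖ ^ 2) :=
      Real.log_le_log (by positivity) (le_add_of_nonneg_left (by positivity))
    have h2 : Real.log (C / P + D * ‖w‖ ^ 2) ≤ Real.log (C + D * ‖w‖ ^ 2) := by
      refine Real.log_le_log (by positivity) ?_
      gcongr
      exact div_le_self hC.le hP
    rw [Real.norm_eq_abs, abs_le]
    have h3 := neg_abs_le (Real.log (D * ‖w‖ ^ 2))
    have h4 := le_abs_self (Real.log (C + D * ‖w‖ ^ 2))
    have h5 := abs_nonneg (Real.log (D * ‖w‖ ^ 2))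
    have h6 := abs_nonneg (Real.log (C + D * ‖w‖ ^ 2))
    constructor <;> linarith
  · filter_upwards [hne] with w hw
    have hw0 : 0 < ‖w‖ := norm_pos_iff.2 hw
    have h1 : Tendsto (fun P : ℝ => C / P + D * ‖w‖ ^ 2) atTop (𝓝 (0 + D * ‖w‖ ^ 2)) :=
      (tendsto_const_nhds.div_atTop tendsto_id).add_const _
    rw [zero_add] at h1
    exact h1.log (by positivity)

/-- At large power `P`, a bound on the information of all channels with splitting ratio `ρ` such
that `ρ (1 - ρ)² ≤ t`. -/
noncomputable def highPowerBound (A B t P : ℝ) : ℝ :=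
  1 / 2 * (3 * Real.log P +
    ∫ w : ℂ, Real.log (((1 + A) ^ 2 + B) / P + 2 * A * B * t * ‖w‖ ^ 2) ∂complexGaussian 1)

/-- With `P³` factored out, the lower order terms are at most `((1 + A)² + B) / P` for every `ρ`,
and `ρ` survives only through the cubic coefficient. This makes the estimate uniform, even near `ρ =
0` and `ρ = 1`. -/
theorem informationBound_le_highPowerBound {A B t P ρ : ℝ} (hA : 0 < A) (hB : 0 < B) (hP : 1 ≤ P)
    (hρ : ρ ∈ Set.Icc (0 : ℝ) 1) (ht : ρ * (1 - ρ) ^ 2 ≤ t) :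
    informationBound (A * ρ * P) (B * (1 - ρ) ^ 2 * P ^ 2) ≤ highPowerBound A B t P := by
  obtain ⟨hρ0, hρ1⟩ := hρ
  have hP0 : 0 < P := one_pos.trans_le hP
  have ht0 : 0 ≤ t := le_trans (by positivity) ht
  have hint := integrable_log_affine_sq_norm (A := ((1 + A) ^ 2 + B) / P) (B := 2 * A * B * t)
    (by positivity) (by positivity)
  have hrw : 3 * Real.log P + ∫ w : ℂ, Real.log (((1 + A) ^ 2 + B) / P +
      2 * A * B * t * ‖w‖ ^ 2) ∂complexGaussian 1 =
      ∫ w : ℂ, (3 * Real.log P + Real.log (((1 + A) ^ 2 + B) / P + 2 * A * B * t * ‖w‖ ^ 2))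
        ∂complexGaussian 1 := by
    rw [integral_add (integrable_const _) hint]
    simp
  rw [highPowerBound, hrw, informationBound]
  have ha0 : 0 ≤ A * ρ * P := by positivity
  have hb0 : 0 ≤ B * (1 - ρ) ^ 2 * P ^ 2 := by positivity
  refine mul_le_mul_of_nonneg_left (integral_mono ?_ ((integrable_const _).add hint)
    fun w => ?_) (by norm_num)
  · refine (integrable_log_affine_sq_norm
      (A := (1 + A * ρ * P) ^ 2 + B * (1 - ρ) ^ 2 * P ^ 2)
      (B := B * (1 - ρ) ^ 2 * P ^ 2 * (2 * (A * ρ * P))) (by positivity) (by positivity)).congr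
      (ae_of_all _ fun w => ?_)
    simp only
    congr 1
    ring
  · simp only
    rw [show (3 : ℝ) * Real.log P = Real.log (P ^ 3) by rw [Real.log_pow]; norm_num,
      ← Real.log_mul (by positivity) (by positivity)]
    refine Real.log_le_log (by positivity) ?_
    have h1 : P ^ 3 * (((1 + A) ^ 2 + B) / P + 2 * A * B * t * ‖w‖ ^ 2) =
        ((1 + A) * P) ^ 2 + B * P ^ 2 + 2 * A * B * P ^ 3 * ‖w‖ ^ 2 * t := by
      field_simp
    have h2 : 1 + A * ρ * P ≤ (1 + A) * P := by
      nlinarith [mul_le_mul_of_nonneg_left hρ1 (mul_nonneg hA.le hP0.le)]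
    have h3 : (1 - ρ) ^ 2 ≤ 1 := pow_le_one₀ (by linarith) (by linarith)
    have h4 : B * (1 - ρ) ^ 2 * P ^ 2 ≤ B * P ^ 2 := by
      have := mul_le_mul_of_nonneg_left h3 (show 0 ≤ B * P ^ 2 by positivity)
      linarith
    have h5 : 2 * A * B * P ^ 3 * ‖w‖ ^ 2 * (ρ * (1 - ρ) ^ 2) ≤
        2 * A * B * P ^ 3 * ‖w‖ ^ 2 * t := mul_le_mul_of_nonneg_left ht (by positivity)
    have h6 : (1 + A * ρ * P) ^ 2 ≤ ((1 + A) * P) ^ 2 := pow_le_pow_left₀ (by positivity) h2 2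
    rw [h1]
    linarith

theorem tendsto_highPowerBound {A B t : ℝ} (hA : 0 < A) (hB : 0 < B) (ht : 0 < t) :
    Tendsto (fun P => highPowerBound A B t P - 3 / 2 * Real.log P) atTop
      (𝓝 (1 / 2 * (Real.log (2 * A * B * t) - Real.eulerMascheroniConstant))) := by
  have h := (tendsto_integral_log_add_mul_sq_norm (C := (1 + A) ^ 2 + B) (D := 2 * A * B * t)
    (by positivity) (by positivity)).const_mul (1 / 2)
  refine h.congr fun P => ?_
  rw [highPowerBound]
  ring

end Asymptotics

/-! ### Maximizing the product of the splitting factors -/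

section Optimum

/-- The deficit from `4/27` has a double root at `1/3` and its other root at `4/3`. On `[0, 1]` the
linear factor is at least `1/3`, which gives a quadratic gap. -/
theorem mul_one_sub_sq_eq (ρ : ℝ) :
    ρ * (1 - ρ) ^ 2 = 4 / 27 - (ρ - 1 / 3) ^ 2 * (4 / 3 - ρ) := by ring

theorem mul_one_sub_sq_le {ρ : ℝ} (hρ : ρ ∈ Set.Icc (0 : ℝ) 1) : ρ * (1 - ρ) ^ 2 ≤ 4 / 27 := by
  rw [mul_one_sub_sq_eq]
  have : 0 ≤ (ρ - 1 / 3) ^ 2 * (4 / 3 - ρ) :=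
    mul_nonneg (sq_nonneg _) (by linarith [hρ.2])
  linarith

theorem mul_one_sub_sq_le_of_le_abs {ρ ε : ℝ} (hρ : ρ ∈ Set.Icc (0 : ℝ) 1) (hε : 0 < ε)
    (h : ε ≤ |ρ - 1 / 3|) : ρ * (1 - ρ) ^ 2 ≤ 4 / 27 - ε ^ 2 / 3 := by
  rw [mul_one_sub_sq_eq]
  have h1 : ε ^ 2 ≤ (ρ - 1 / 3) ^ 2 := by
    rw [← sq_abs (ρ - 1 / 3)]
    exact pow_le_pow_left₀ hε.le h 2
  nlinarith [hρ.2, sq_nonneg (ρ - 1 / 3)]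

theorem theta₁_one (h : ℂ) (ρ : ℝ) :
    theta₁ (fun _ : Fin 1 => h) (fun _ => ρ) = ρ * ‖h‖ ^ 2 := by
  simp [theta₁]

theorem theta₂_one (h : ℂ) (ρ : ℝ) :
    theta₂ (fun _ : Fin 1 => h) (fun _ => ρ) = (1 - ρ) ^ 2 * ‖h‖ ^ 4 := by
  simp [theta₂]

end Optimum

/-! ### From divergences to the information of the receiver -/

section Information

open InformationTheory

variable {Ω : Type*} [MeasurableSpace Ω] {μ : Measure Ω} {X Z : Ω → ℂ} {N : Ω → ℝ}

theorem isGaussianChannel_of_indepFun [IsProbabilityMeasure μ] {σ ς : ℝ}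
    (hX : HasLaw X (complexGaussian 1) μ) (hZ : HasLaw Z (complexGaussian σ.toNNReal) μ)
    (hN : HasLaw N (gaussianReal 0 ς.toNNReal) μ) (hZN : IndepFun Z N μ)
    (hXZN : IndepFun X (fun ω => (Z ω, N ω)) μ) : IsGaussianChannel μ X Z N σ ς := by
  have h1 := (indepFun_iff_hasLaw_prodMk_prod hZ hN).1 hZN
  exact (indepFun_iff_hasLaw_prodMk_prod hX h1).1 hXZN

/-- Scaling the input does not change the mutual information. -/
theorem klDiv_map_const_mul {β : Type*} [MeasurableSpace β] [IsProbabilityMeasure μ] {V : Ω → β}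
    (hX : AEMeasurable X μ) (hV : AEMeasurable V μ) {c : ℂ} (hc : c ≠ 0) :
    klDiv (μ.map fun ω => (c * X ω, V ω)) ((μ.map fun ω => c * X ω).prod (μ.map V)) =
      klDiv (μ.map fun ω => (X ω, V ω)) ((μ.map X).prod (μ.map V)) := by
  -- Data processing gives one inequality; applied to `c⁻¹` it gives the other.
  have key : ∀ (c : ℂ) (X : Ω → ℂ), AEMeasurable X μ →
      klDiv (μ.map fun ω => (c * X ω, V ω)) ((μ.map fun ω => c * X ω).prod (μ.map V)) ≤
        klDiv (μ.map fun ω => (X ω, V ω)) ((μ.map X).prod (μ.map V)) := by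
    intro c X hX
    have := Measure.isProbabilityMeasure_map hX
    have := Measure.isProbabilityMeasure_map hV
    have := Measure.isProbabilityMeasure_map (hX.prodMk hV)
    have hm : Measurable (Prod.map (fun x : ℂ => c * x) (id : β → β)) := by fun_prop
    have h := klDiv_map_le (μ := μ.map fun ω => (X ω, V ω)) (ν := (μ.map X).prod (μ.map V)) hm
    rw [AEMeasurable.map_map_of_aemeasurable hm.aemeasurable (hX.prodMk hV),
      ← Measure.map_prod_map _ _ (by fun_prop) measurable_id, Measure.map_id,
      AEMeasurable.map_map_of_aemeasurable (by fun_prop) hX] at h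
    exact h
  refine le_antisymm (key c X hX) ?_
  have h := key c⁻¹ (fun ω => c * X ω) (hX.const_mul c)
  simpa only [inv_mul_cancel_left₀ hc] using h

variable {h : ℂ} {σ₁ σ₂ : ℝ}

theorem singleAntennaInformation_eq (hG : IsGaussianChannel μ X Z N (σ₁ ^ 2) (σ₂ ^ 2)) {P : ℝ}
    (hP : 0 < P) (ρ : ℝ) {α k : ℝ} (hα : α = √(ρ * ‖h‖ ^ 2) * √P)
    (hk : k = √((1 - ρ) ^ 2 * ‖h‖ ^ 4) * P) :
    singleAntennaInformation μ X Z N h P ρ =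
      klDiv (μ.map fun ω => (X ω, ((α : ℂ) * X ω + Z ω, k * ‖X ω‖ ^ 2 + N ω)))
        ((μ.map X).prod (μ.map fun ω => ((α : ℂ) * X ω + Z ω, k * ‖X ω‖ ^ 2 + N ω))) /
          ENNReal.ofReal (Real.log 2) := by
  have := hG.isProbabilityMeasure
  have hXm : AEMeasurable X μ := hG.hasLaw_input.aemeasurable
  have hZm : AEMeasurable Z μ := hG.hasLaw_linear_noise.aemeasurable
  have hNm : AEMeasurable N μ := hG.hasLaw_power_noise.aemeasurable
  have hVm : AEMeasurable (fun ω => ((α : ℂ) * X ω + Z ω, k * ‖X ω‖ ^ 2 + N ω)) μ := by fun_prop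
  have hP' : ((√P : ℝ) : ℂ) ≠ 0 := by exact_mod_cast (Real.sqrt_pos.2 hP).ne'
  rw [← klDiv_map_const_mul hXm hVm hP']
  simp only [singleAntennaInformation, splittingInformation, mutualInformation, channelOutput,
    theta₁_one, theta₂_one, hα, hk]

theorem toReal_div_log_two (x : ℝ≥0∞) :
    (x / ENNReal.ofReal (Real.log 2)).toReal = x.toReal / Real.log 2 := by
  rw [ENNReal.toReal_div, ENNReal.toReal_ofReal (Real.log_pos one_lt_two).le]

theorem singleAntennaInformation_le (hG : IsGaussianChannel μ X Z N (σ₁ ^ 2) (σ₂ ^ 2))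
    (hσ₁ : 0 < σ₁) (hσ₂ : 0 < σ₂) {P ρ : ℝ} (hP : 0 < P) (hρ : ρ ∈ Set.Icc (0 : ℝ) 1) :
    singleAntennaInformation μ X Z N h P ρ ≠ ⊤ ∧
      (singleAntennaInformation μ X Z N h P ρ).toReal ≤
        informationBound (‖h‖ ^ 2 / σ₁ ^ 2 * ρ * P)
          (‖h‖ ^ 4 / σ₂ ^ 2 * (1 - ρ) ^ 2 * P ^ 2) / Real.log 2 := by
  obtain ⟨α, hα⟩ : ∃ α, α = √(ρ * ‖h‖ ^ 2) * √P := ⟨_, rfl⟩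
  obtain ⟨k, hk⟩ : ∃ k, k = √((1 - ρ) ^ 2 * ‖h‖ ^ 4) * P := ⟨_, rfl⟩
  obtain ⟨h1, h2⟩ := hG.toReal_klDiv_le (by positivity) (by positivity) α k
  have hα2 : α ^ 2 / σ₁ ^ 2 = ‖h‖ ^ 2 / σ₁ ^ 2 * ρ * P := by
    rw [hα, mul_pow, Real.sq_sqrt (mul_nonneg hρ.1 (by positivity)), Real.sq_sqrt hP.le]
    ring
  have hk2 : k ^ 2 / σ₂ ^ 2 = ‖h‖ ^ 4 / σ₂ ^ 2 * (1 - ρ) ^ 2 * P ^ 2 := by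
    rw [hk, mul_pow, Real.sq_sqrt (by positivity)]
    ring
  rw [hα2, hk2] at h2
  have hlog := Real.log_pos one_lt_two
  rw [singleAntennaInformation_eq hG hP ρ hα hk, toReal_div_log_two]
  exact ⟨ENNReal.div_ne_top h1 (ENNReal.ofReal_pos.2 hlog).ne',
    div_le_div_of_nonneg_right h2 hlog.le⟩

/-- The information at splitting ratio `1 / 3` is at least the high power value minus an error that
vanishes as the power grows. -/
theorem exists_le_singleAntennaInformation (hG : IsGaussianChannel μ X Z N (σ₁ ^ 2) (σ₂ ^ 2))
    (hh : h ≠ 0) (hσ₁ : 0 < σ₁) (hσ₂ : 0 < σ₂) :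
    ∃ e : ℝ → ℝ, Tendsto e atTop (𝓝 0) ∧ ∀ P, 0 < P →
      (1 / 2 * (Real.log (2 * (‖h‖ ^ 2 / σ₁ ^ 2) * (‖h‖ ^ 4 / σ₂ ^ 2) * (4 / 27)) +
        3 * Real.log P) - Real.eulerMascheroniConstant / 2 + e P) / Real.log 2 ≤
      (singleAntennaInformation μ X Z N h P (1 / 3)).toReal := by
  have hh0 : 0 < ‖h‖ := norm_pos_iff.2 hh
  have hσ : 0 < σ₁ ^ 2 := by positivity
  have hlim : Tendsto (fun P : ℝ => √(1 / 3 * ‖h‖ ^ 2) * √P) atTop atTop :=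
    Real.tendsto_sqrt_atTop.const_mul_atTop (by positivity)
  have h2 := (((hG.tendsto_integral_sq_phaseError hσ).comp hlim).div_const
    (σ₁ ^ 2)).const_sub (1 / 2)
  -- The guessed phase variance is asymptotically exact, so the defect vanishes.
  have h3 : 1 / 2 - σ₁ ^ 2 / 2 / σ₁ ^ 2 = 0 := by field_simp; norm_num
  rw [h3] at h2
  refine ⟨_, h2, fun P hP => ?_⟩
  have h1 := hG.le_toReal_klDiv hσ (by positivity)
    (α := √(1 / 3 * ‖h‖ ^ 2) * √P) (k := √((1 - 1 / 3) ^ 2 * ‖h‖ ^ 4) * P)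
    (by positivity) (by norm_num; positivity)
  rw [singleAntennaInformation_eq hG hP (1 / 3) rfl rfl, toReal_div_log_two]
  refine div_le_div_of_nonneg_right (le_trans (le_of_eq ?_) h1) (Real.log_pos one_lt_two).le
  have h4 : 2 * ((√(1 / 3 * ‖h‖ ^ 2) * √P) ^ 2 / σ₁ ^ 2) *
      ((√((1 - 1 / 3) ^ 2 * ‖h‖ ^ 4) * P) ^ 2 / σ₂ ^ 2) =
      2 * (‖h‖ ^ 2 / σ₁ ^ 2) * (‖h‖ ^ 4 / σ₂ ^ 2) * (4 / 27) * P ^ 3 := by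
    have e1 : √(1 / 3 * ‖h‖ ^ 2) ^ 2 = 1 / 3 * ‖h‖ ^ 2 := Real.sq_sqrt (by positivity)
    have e2 : √((1 - 1 / 3) ^ 2 * ‖h‖ ^ 4) ^ 2 = (1 - 1 / 3) ^ 2 * ‖h‖ ^ 4 :=
      Real.sq_sqrt (by positivity)
    rw [mul_pow, mul_pow, e1, e2, Real.sq_sqrt hP.le]
    ring
  rw [h4, Real.log_mul (x := 2 * (‖h‖ ^ 2 / σ₁ ^ 2) * (‖h‖ ^ 4 / σ₂ ^ 2) * (4 / 27))
    (by positivity) (by positivity), Real.log_pow, Nat.cast_ofNat]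
  rfl

theorem highSNRValue_eq (hh : h ≠ 0) (hσ₁ : 0 < σ₁) (hσ₂ : 0 < σ₂) {P : ℝ} (hP : 0 < P) :
    highSNRValue h σ₁ σ₂ P =
      (1 / 2 * (Real.log (2 * (‖h‖ ^ 2 / σ₁ ^ 2) * (‖h‖ ^ 4 / σ₂ ^ 2) * (4 / 27)) +
        3 * Real.log P) - Real.eulerMascheroniConstant / 2) / Real.log 2 := by
  have hh0 : 0 < ‖h‖ := norm_pos_iff.2 hh
  have hlog := Real.log_pos one_lt_two
  have h1 : Real.log (2 * √2 / (3 * √3) * (‖h‖ ^ 3 * P ^ (3 / 2 : ℝ) / (σ₁ * σ₂))) =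
      1 / 2 * (Real.log (2 * (‖h‖ ^ 2 / σ₁ ^ 2) * (‖h‖ ^ 4 / σ₂ ^ 2) * (4 / 27)) +
        3 * Real.log P) := by
    -- Squaring removes the roots; the constant is `8/27 = 2 * (4/27)`.
    have hsq : (2 * √2 / (3 * √3) * (‖h‖ ^ 3 * P ^ (3 / 2 : ℝ) / (σ₁ * σ₂))) ^ 2 =
        2 * (‖h‖ ^ 2 / σ₁ ^ 2) * (‖h‖ ^ 4 / σ₂ ^ 2) * (4 / 27) * P ^ 3 := by
      have hP2 : (P ^ (3 / 2 : ℝ)) ^ 2 = P ^ 3 := by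
        rw [← Real.rpow_natCast, ← Real.rpow_mul hP.le, ← Real.rpow_natCast]
        norm_num
      have e2 : √2 ^ 2 = 2 := Real.sq_sqrt (by norm_num)
      have e3 : √3 ^ 2 = 3 := Real.sq_sqrt (by norm_num)
      rw [mul_pow, div_pow, div_pow, mul_pow, mul_pow, mul_pow, e2, e3, hP2]
      field_simp
      norm_num
    have h3 := Real.log_pow 2 (x := 2 * √2 / (3 * √3) * (‖h‖ ^ 3 * P ^ (3 / 2 : ℝ) / (σ₁ * σ₂)))
    rw [hsq, Real.log_mul (x := 2 * (‖h‖ ^ 2 / σ₁ ^ 2) * (‖h‖ ^ 4 / σ₂ ^ 2) * (4 / 27))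
      (by positivity) (by positivity), Real.log_pow] at h3
    push_cast at h3
    linarith
  rw [highSNRValue, Real.logb, h1]
  field_simp

end Information

end SplittingReceiver

/-! ### Comparison of the two bounds -/

theorem proposition1 {Ω : Type*} [MeasurableSpace Ω] (μ : Measure Ω) [IsProbabilityMeasure μ]
    (X Z : Ω → ℂ) (N : Ω → ℝ) (h : ℂ) (σ₁ σ₂ : ℝ)
    (hh : h ≠ 0) (hσ₁ : 0 < σ₁) (hσ₂ : 0 < σ₂)
    (hX : HasLaw X (SplittingReceiver.complexGaussian 1) μ)
    (hZ : HasLaw Z (SplittingReceiver.complexGaussian (σ₁ ^ 2).toNNReal) μ)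
    (hN : HasLaw N (gaussianReal 0 (σ₂ ^ 2).toNNReal) μ)
    (hZN : IndepFun Z N μ) (hXZN : IndepFun X (fun ω => (Z ω, N ω)) μ) :
    -- the mutual information is finite, uniformly over the splitting ratio
    (∀ P : ℝ, 0 < P →
      (⨆ ρ ∈ Set.Icc (0 : ℝ) 1,
        SplittingReceiver.singleAntennaInformation μ X Z N h P ρ) < ⊤) ∧
    -- `ρ = 1/3` is the unique maximizer of `ρ (1 - ρ)²`, and of `Θ₁ Θ₂`, over `[0, 1]`
    (∀ ρ ∈ Set.Icc (0 : ℝ) 1, ρ ≠ 1 / 3 →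
      ρ * (1 - ρ) ^ 2 < 1 / 3 * (1 - 1 / 3) ^ 2 ∧
      SplittingReceiver.theta₁ (fun _ : Fin 1 => h) (fun _ => ρ) *
          SplittingReceiver.theta₂ (fun _ : Fin 1 => h) (fun _ => ρ) <
        SplittingReceiver.theta₁ (fun _ : Fin 1 => h) (fun _ => 1 / 3) *
          SplittingReceiver.theta₂ (fun _ : Fin 1 => h) (fun _ => 1 / 3)) ∧
    -- at high SNR, every ratio outside a given neighbourhood of `1/3` is worse than `1/3`,
    -- by a fixed margin
    (∀ ε : ℝ, 0 < ε → ∃ δ : ℝ, 0 < δ ∧ ∀ᶠ P : ℝ in atTop,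
      ∀ ρ ∈ Set.Icc (0 : ℝ) 1, ε ≤ |ρ - 1 / 3| →
        (SplittingReceiver.singleAntennaInformation μ X Z N h P ρ).toReal + δ ≤
          (SplittingReceiver.singleAntennaInformation μ X Z N h P (1 / 3)).toReal) ∧
    -- the mutual information at `ρ = 1/3`
    Tendsto (fun P : ℝ =>
        (SplittingReceiver.singleAntennaInformation μ X Z N h P (1 / 3)).toReal -
          SplittingReceiver.highSNRValue h σ₁ σ₂ P) atTop (𝓝 0) ∧
    -- the largest mutual information over all splitting ratios
    Tendsto (fun P : ℝ =>
        (⨆ ρ ∈ Set.Icc (0 : ℝ) 1,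
          SplittingReceiver.singleAntennaInformation μ X Z N h P ρ).toReal -
          SplittingReceiver.highSNRValue h σ₁ σ₂ P) atTop (𝓝 0) := by
  have hG := SplittingReceiver.isGaussianChannel_of_indepFun hX hZ hN hZN hXZN
  have hh0 : 0 < ‖h‖ := norm_pos_iff.2 hh
  have hlog := Real.log_pos one_lt_two
  obtain ⟨A, hA⟩ : ∃ A, A = ‖h‖ ^ 2 / σ₁ ^ 2 := ⟨_, rfl⟩
  obtain ⟨B, hB⟩ : ∃ B, B = ‖h‖ ^ 4 / σ₂ ^ 2 := ⟨_, rfl⟩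
  have hA0 : 0 < A := by rw [hA]; positivity
  have hB0 : 0 < B := by rw [hB]; positivity
  have hmem : (1 / 3 : ℝ) ∈ Set.Icc (0 : ℝ) 1 := by constructor <;> norm_num
  have hle : ∀ {P ρ : ℝ}, 0 < P → ρ ∈ Set.Icc (0 : ℝ) 1 →
      SplittingReceiver.singleAntennaInformation μ X Z N h P ρ ≠ ⊤ ∧
      (SplittingReceiver.singleAntennaInformation μ X Z N h P ρ).toReal ≤
        SplittingReceiver.informationBound (A * ρ * P) (B * (1 - ρ) ^ 2 * P ^ 2) / Real.log 2 :=
    fun hP hρ => hA ▸ hB ▸ SplittingReceiver.singleAntennaInformation_le hG hσ₁ hσ₂ hP hρ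
  have hle' : ∀ {P ρ t : ℝ}, 1 ≤ P → ρ ∈ Set.Icc (0 : ℝ) 1 → ρ * (1 - ρ) ^ 2 ≤ t →
      (SplittingReceiver.singleAntennaInformation μ X Z N h P ρ).toReal ≤
        SplittingReceiver.highPowerBound A B t P / Real.log 2 := fun hP hρ ht =>
    (hle (one_pos.trans_le hP) hρ).2.trans (div_le_div_of_nonneg_right
      (SplittingReceiver.informationBound_le_highPowerBound hA0 hB0 hP hρ ht) hlog.le)
  obtain ⟨e, he, hlow⟩ :=
    SplittingReceiver.exists_le_singleAntennaInformation hG hh hσ₁ hσ₂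
  have hval : ∀ P : ℝ, 0 < P → SplittingReceiver.highSNRValue h σ₁ σ₂ P =
      (1 / 2 * (Real.log (2 * A * B * (4 / 27)) + 3 * Real.log P) -
        Real.eulerMascheroniConstant / 2) / Real.log 2 := fun P hP => by
    rw [hA, hB]; exact SplittingReceiver.highSNRValue_eq hh hσ₁ hσ₂ hP
  have hlow' : ∀ P : ℝ, 0 < P → e P / Real.log 2 ≤
      (SplittingReceiver.singleAntennaInformation μ X Z N h P (1 / 3)).toReal -
        SplittingReceiver.highSNRValue h σ₁ σ₂ P := fun P hP => by
    have h1 := hlow P hP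
    rw [← hA, ← hB, add_div, ← hval P hP] at h1
    linarith
  have hlow0 : Tendsto (fun P => e P / Real.log 2) atTop (𝓝 0) := by
    simpa using he.div_const (Real.log 2)
  have hup : ∀ t : ℝ, 0 < t → Tendsto (fun P => SplittingReceiver.highPowerBound A B t P /
      Real.log 2 - SplittingReceiver.highSNRValue h σ₁ σ₂ P) atTop
      (𝓝 (1 / 2 * (Real.log t - Real.log (4 / 27)) / Real.log 2)) := fun t ht => by
    have h1 := ((SplittingReceiver.tendsto_highPowerBound hA0 hB0 ht).sub_const
      (1 / 2 * Real.log (2 * A * B * (4 / 27)) -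
        Real.eulerMascheroniConstant / 2)).div_const (Real.log 2)
    rw [Real.log_mul (x := 2 * A * B) (by positivity) ht.ne',
      Real.log_mul (x := 2 * A * B) (y := 4 / 27) (by positivity) (by norm_num)] at h1
    have h2 : 1 / 2 * (Real.log (2 * A * B) + Real.log t - Real.eulerMascheroniConstant) -
        (1 / 2 * (Real.log (2 * A * B) + Real.log (4 / 27)) -
          Real.eulerMascheroniConstant / 2) = 1 / 2 * (Real.log t - Real.log (4 / 27)) := by ring
    rw [h2] at h1
    refine h1.congr' ?_
    filter_upwards [eventually_gt_atTop 0] with P hP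
    rw [hval P hP, Real.log_mul (x := 2 * A * B) (y := 4 / 27) (by positivity) (by norm_num)]
    ring
  have hup0 : Tendsto (fun P => SplittingReceiver.highPowerBound A B (4 / 27) P /
      Real.log 2 - SplittingReceiver.highSNRValue h σ₁ σ₂ P) atTop (𝓝 0) := by
    simpa using hup (4 / 27) (by norm_num)
  have hsup_le : ∀ P c : ℝ, 0 < P → (∀ ρ ∈ Set.Icc (0 : ℝ) 1,
      (SplittingReceiver.singleAntennaInformation μ X Z N h P ρ).toReal ≤ c) →
      (⨆ ρ ∈ Set.Icc (0 : ℝ) 1, SplittingReceiver.singleAntennaInformation μ X Z N h P ρ) ≤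
        ENNReal.ofReal c := fun P c hP hc =>
    iSup₂_le fun ρ hρ => (ENNReal.le_ofReal_iff_toReal_le (hle hP hρ).1
      (ENNReal.toReal_nonneg.trans (hc ρ hρ))).2 (hc ρ hρ)
  have hfin : ∀ P : ℝ, 0 < P → (⨆ ρ ∈ Set.Icc (0 : ℝ) 1,
      SplittingReceiver.singleAntennaInformation μ X Z N h P ρ) < ⊤ := fun P hP => by
    refine (hsup_le P (SplittingReceiver.informationBound (A * P) (B * P ^ 2) / Real.log 2) hP
      fun ρ hρ => (hle hP hρ).2.trans ?_).trans_lt ENNReal.ofReal_lt_top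
    have hρ0 := hρ.1
    have hρ1 := hρ.2
    refine div_le_div_of_nonneg_right (SplittingReceiver.informationBound_mono (by positivity)
      (by positivity) ?_ ?_) hlog.le
    · have := mul_le_mul_of_nonneg_left hρ1 (mul_pos hA0 hP).le
      linarith
    · have h1 : (1 - ρ) ^ 2 ≤ 1 := pow_le_one₀ (by linarith) (by linarith)
      have := mul_le_mul_of_nonneg_left h1 (show 0 ≤ B * P ^ 2 by positivity)
      linarith
  refine ⟨hfin, ?_, ?_, ?_, ?_⟩
  · intro ρ hρ hne
    have h1 : ρ * (1 - ρ) ^ 2 < 1 / 3 * (1 - 1 / 3) ^ 2 := by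
      rw [SplittingReceiver.mul_one_sub_sq_eq]
      have : 0 < (ρ - 1 / 3) ^ 2 * (4 / 3 - ρ) :=
        mul_pos (by have := sub_ne_zero.2 hne; positivity) (by linarith [hρ.2])
      linarith
    refine ⟨h1, ?_⟩
    simp only [SplittingReceiver.theta₁_one, SplittingReceiver.theta₂_one]
    have h2 := mul_lt_mul_of_pos_right h1 (show 0 < ‖h‖ ^ 6 by positivity)
    linarith
  · intro ε hε
    -- The maximum with `1/27` keeps `t` positive for large `ε`, so that `log t` is meaningful; any
    -- constant in `(0, 4/27)` would do.
    obtain ⟨t, ht⟩ : ∃ t : ℝ, t = max (4 / 27 - ε ^ 2 / 3) (1 / 27) := ⟨_, rfl⟩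
    have ht0 : 0 < t := by rw [ht]; exact lt_max_of_lt_right (by norm_num)
    have ht1 : t < 4 / 27 := by
      rw [ht]; exact max_lt (by have := sq_pos_of_pos hε; linarith) (by norm_num)
    have hgap : 0 < 1 / 2 * (Real.log (4 / 27) - Real.log t) / Real.log 2 := by
      have := Real.log_lt_log ht0 ht1
      exact div_pos (by linarith) hlog
    set g := 1 / 2 * (Real.log (4 / 27) - Real.log t) / Real.log 2 with hg
    refine ⟨g / 2, by positivity, ?_⟩
    -- The lower bound at `1/3` minus the upper bound outside the neighbourhood tends to `g > 0`, so
    -- it eventually exceeds `g / 2`.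
    have hlim := hlow0.sub (hup t ht0)
    have hlim' : 0 - 1 / 2 * (Real.log t - Real.log (4 / 27)) / Real.log 2 = g := by
      rw [hg]; ring
    rw [hlim'] at hlim
    filter_upwards [hlim.eventually_const_lt (half_lt_self hgap), eventually_ge_atTop 1]
      with P hP hP1 ρ hρ hρε
    have h1 := hle' hP1 hρ ((SplittingReceiver.mul_one_sub_sq_le_of_le_abs hρ hε hρε).trans
      (ht ▸ le_max_left _ _))
    have h2 := hlow' P (one_pos.trans_le hP1)
    linarith
  · refine tendsto_of_tendsto_of_tendsto_of_le_of_le' hlow0 hup0 ?_ ?_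
    · filter_upwards [eventually_gt_atTop 0] with P hP using hlow' P hP
    · filter_upwards [eventually_ge_atTop 1] with P hP
      have h1 := hle' hP hmem (SplittingReceiver.mul_one_sub_sq_le hmem)
      linarith
  · refine tendsto_of_tendsto_of_tendsto_of_le_of_le' hlow0 hup0 ?_ ?_
    · filter_upwards [eventually_gt_atTop 0] with P hP
      have h1 : (SplittingReceiver.singleAntennaInformation μ X Z N h P (1 / 3)).toReal ≤
          (⨆ ρ ∈ Set.Icc (0 : ℝ) 1,
            SplittingReceiver.singleAntennaInformation μ X Z N h P ρ).toReal :=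
        ENNReal.toReal_mono (hfin P hP).ne (le_iSup₂_of_le (1 / 3) hmem le_rfl)
      have h2 := hlow' P hP
      linarith
    · filter_upwards [eventually_ge_atTop 1] with P hP
      have hbound : ∀ ρ ∈ Set.Icc (0 : ℝ) 1,
          (SplittingReceiver.singleAntennaInformation μ X Z N h P ρ).toReal ≤
            SplittingReceiver.highPowerBound A B (4 / 27) P / Real.log 2 := fun ρ hρ =>
        hle' hP hρ (SplittingReceiver.mul_one_sub_sq_le hρ)
      have h1 := ENNReal.toReal_le_of_le_ofReal
        (ENNReal.toReal_nonneg.trans (hbound _ hmem))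
        (hsup_le P _ (one_pos.trans_le hP) hbound)
      linarith
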